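/- Let $n\ge 0$ be an integer. Let $\mathcal T_n$ be the set of trees on the vertex set $\{0,1,\dots,n\}$, rooted at $0$. The *total depth* $\mathrm{depth}(T)$ of $T\in\mathcal T_n$ is the sum of the distances from the root to all other vertices. For distinct vertices $i,j$, the vertex $j$ is a *descendant* of $i$ if $i$ lies on the path from $j$ to the root; $\mathrm{inv}(T)$ (respectively $\mathrm{coinv}(T)$) is the number of pairs $(i,j)$ such that $j$ is a descendant of $i$ and $i>j$ (respectively $i<j$). Put $$D_n(q):=\sum_{T\in\mathcal T_n}q^{\mathrm{inv}(T)+\mathrm{coinv}(T)}.$$ Let $\mathcal F_n$ be the set of sequences of $n$ transpositions $f=(a_1\,b_1)\cdots(a_n\,b_n)$ of $\{0,1,\dots,n\}$, written with $a_i<b_i$, whose product, multiplied from left to right, is the full cycle $(0\,1\,\cdots\,n)$. The *total difference* of $f$ is $\mathrm{diff}(f):=\sum_{i=1}^n(b_i-a_i)$. Let $\mathcal P_n$ be the set of parking functions of length $n$, that is, sequences $p\in\mathbb N^n$ of nonnegative integers whose non-decreasing rearrangement $(a_1',\dots,a_n')$ satisfies $a_i'\le i-1$ for all $i$. Such a $p$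 determines the lattice path $P$ from $(0,0)$ to $(n,n)$ with unit east and north steps whose $j$-th east step is at height $a_j'$. A ball starts at $(0,0)$. Whenever it is at a point $(i,i)$ with $i<n$, it moves east until it is blocked by a north step of $P$ that starts at height $i$, at abscissa $x$ say, and then moves north to $(x,x)$; it stops at $(n,n)$. If $0=i_1<\dots<i_m=n$ are the abscissas at which the ball meets the line $y=x$, then $\mathrm{bounce}(p):=\sum_{j=1}^m(n-i_j)$. **Theorem.** For every $k\in\mathbb N$ the following are equinumerous: (1) trees $T\in\mathcal T_n$ with total depth $k$; (2) factorizations $f\in\mathcal F_n$ with total difference $k$; (3) parking functions $p\in\mathcal P_n$ with bounce $k$. That is, $$D_n(q)=\sum_{T\in\mathcal T_n}q^{\mathrm{depth}(T)}=\sum_{f\in\mathcal F_n}q^{\mathrm{diff}(f)}=\sum_{p\in\mathcal P_n}q^{\mathrm{bounce}(p)}.$$ -/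

import Mathlib

open Polynomial

noncomputable section

namespace DepthBounce

/-! ### Labelled trees on the vertices `0, 1, …, n`, rooted at `0` -/

open Classical in
/-- The set of all trees on the vertex set `{0, 1, …, n}`. -/
def labelledTrees (n : ℕ) : Finset (SimpleGraph (Fin (n + 1))) :=
  Finset.univ.filter fun T => T.IsTree

/-- `j` is a descendant of `i`: the vertices are distinct and `i` lies on the path from `j`
to the root `0` (in a tree, this path exists and is unique). -/
def IsDescendant {n : ℕ} (T : SimpleGraph (Fin (n + 1))) (i j : Fin (n + 1)) : Prop :=
  i ≠ j ∧ ∃ w : T.Walk j 0, w.IsPath ∧ i ∈ w.support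

open Classical in
/-- The number of inversions: pairs `(i, j)` with `j` a descendant of `i` and `i > j`. -/
def inv {n : ℕ} (T : SimpleGraph (Fin (n + 1))) : ℕ :=
  (Finset.univ.filter fun ij : Fin (n + 1) × Fin (n + 1) =>
    IsDescendant T ij.1 ij.2 ∧ ij.2 < ij.1).card

open Classical in
/-- The number of coinversions: pairs `(i, j)` with `j` a descendant of `i` and `i < j`. -/
def coinv {n : ℕ} (T : SimpleGraph (Fin (n + 1))) : ℕ :=
  (Finset.univ.filter fun ij : Fin (n + 1) × Fin (n + 1) =>
    IsDescendant T ij.1 ij.2 ∧ ij.1 < ij.2).card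

/-- The total depth: the sum of the distances from the root to all vertices. -/
def totalDepth {n : ℕ} (T : SimpleGraph (Fin (n + 1))) : ℕ :=
  ∑ v, T.dist 0 v

/-- The polynomial `D_n(q) = ∑_T q ^ (inv T + coinv T)`. -/
def D (n : ℕ) : ℤ[X] :=
  ∑ T ∈ labelledTrees n, X ^ (inv T + coinv T)

/-! ### Minimal factorizations of the full cycle `(0 1 ⋯ n)` -/

/-- The product `t₁ t₂ ⋯ tₙ`, multiplied from left to right: `t₁` is applied first. (Mathlib
multiplies permutations from right to left, so the list of factors is reversed.) -/
def leftToRightProd {n : ℕ} (t : Fin n → Equiv.Perm (Fin (n + 1))) :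
    Equiv.Perm (Fin (n + 1)) :=
  (List.ofFn t).reverse.prod

open Classical in
/-- Sequences of `n` transpositions whose left-to-right product is the full cycle
`(0 1 ⋯ n)`, which is `finRotate (n + 1)`. -/
def minimalFactorizations (n : ℕ) : Finset (Fin n → Equiv.Perm (Fin (n + 1))) :=
  Finset.univ.filter fun t =>
    (∀ i, (t i).IsSwap) ∧ leftToRightProd t = finRotate (n + 1)

/-- The least element `a` moved by a transposition `(a b)`, where `a < b`. -/
def lower {n : ℕ} (τ : Equiv.Perm (Fin (n + 1))) : Fin (n + 1) := τ.support.inf id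

/-- The greatest element `b` moved by a transposition `(a b)`, where `a < b`. -/
def upper {n : ℕ} (τ : Equiv.Perm (Fin (n + 1))) : Fin (n + 1) := τ.support.sup id

theorem lower_swap {n : ℕ} {a b : Fin (n + 1)} (h : a < b) : lower (Equiv.swap a b) = a := by
  simp [lower, Equiv.Perm.support_swap h.ne, h.le]

theorem upper_swap {n : ℕ} {a b : Fin (n + 1)} (h : a < b) : upper (Equiv.swap a b) = b := by
  simp [upper, Equiv.Perm.support_swap h.ne, h.le]

/-- The total difference `∑ᵢ (bᵢ - aᵢ)` of `(a₁ b₁) ⋯ (aₙ bₙ)`, where `aᵢ < bᵢ`. -/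
def totalDifference {n : ℕ} (t : Fin n → Equiv.Perm (Fin (n + 1))) : ℕ :=
  ∑ i, ((upper (t i) : ℕ) - (lower (t i) : ℕ))

/-! ### Parking functions and the bounce statistic -/

/-- The non-decreasing rearrangement of a sequence. -/
def rearrangement {n : ℕ} (a : Fin n → ℕ) : Fin n → ℕ := a ∘ Tuple.sort a

/-- The non-decreasing rearrangement `(a'₁, …, a'ₙ)` satisfies `a'ᵢ ≤ i - 1` for all `i`
(indices are counted from `0` here). -/
def IsParkingFunction {n : ℕ} (a : Fin n → ℕ) : Prop :=
  ∀ i : Fin n, rearrangement a i ≤ i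

open Classical in
/-- The finite set of parking functions of length `n`; all their entries are less than `n`. -/
def parkingFunctions (n : ℕ) : Finset (Fin n → ℕ) :=
  (Fintype.piFinset fun _ => Finset.range n).filter IsParkingFunction

theorem mem_parkingFunctions {n : ℕ} {a : Fin n → ℕ} :
    a ∈ parkingFunctions n ↔ IsParkingFunction a := by
  simp only [parkingFunctions, Finset.mem_filter, Fintype.mem_piFinset, Finset.mem_range,
    and_iff_right_iff_imp]
  intro h i
  have h1 := h ((Tuple.sort a).symm i)
  simp only [rearrangement, Function.comp_apply, Equiv.apply_symm_apply] at h1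
  exact h1.trans_lt (Fin.is_lt _)

/-- The lattice path of `a` from `(0, 0)` to `(n, n)` has, for each `x < n`, one horizontal step
from abscissa `x` to `x + 1`, at the height `rearrangement a x`. After the last horizontal
step the path rises to the height `n`. -/
def stepHeight {n : ℕ} (a : Fin n → ℕ) (x : ℕ) : ℕ :=
  if h : x < n then rearrangement a ⟨x, h⟩ else n

/-- The lattice path of `a` contains the vertical step from `(x, y)` to `(x, y + 1)`: at the
abscissa `x` it arrives at height at most `y` and leaves at height at least `y + 1`. -/
def HasVerticalStep {n : ℕ} (a : Fin n → ℕ) (x y : ℕ) : Prop :=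
  x ≤ n ∧ (0 < x → stepHeight a (x - 1) ≤ y) ∧ y + 1 ≤ stepHeight a x

/-- The bouncing ball meets the diagonal at `(x, x)`. It starts at `(0, 0)`. From a point
`(i, i)` of the diagonal with `i < n` it moves east, at height `i`, until it is blocked by a
vertical step of the path (one that goes up from height `i`), at abscissa `x` say; then it moves
north from `(x, i)` to the point `(x, x)` of the diagonal. It stops at `(n, n)`. -/
inductive MeetsDiagonal {n : ℕ} (a : Fin n → ℕ) : ℕ → Prop
  | start : MeetsDiagonal a 0
  | bounce {i x : ℕ} (hi : MeetsDiagonal a i) (hin : i < n)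
      (hx : IsLeast {x | i ≤ x ∧ HasVerticalStep a x i} x) : MeetsDiagonal a x

open Classical in
/-- The bounce of `a`: the sum of `n - i` over the points `(i, i)`, `0 ≤ i ≤ n`, at which the ball
meets the diagonal. -/
def bounce {n : ℕ} (a : Fin n → ℕ) : ℕ :=
  ∑ i ∈ (Finset.range (n + 1)).filter (MeetsDiagonal a), (n - i)

end DepthBounce

end

open DepthBounce

open Polynomial

noncomputable section

namespace DepthBounce

/-! All three families are compared with trees, through the depths of the vertices. The vertices `i`
of which `j` is a descendant are those on the path from `j` to the root, other than `j`, so they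
number `T.dist 0 j`; splitting them by size gives `inv_add_coinv`.

For factorizations, let the height of a point `p` be the number of pairs `(a, b)` with `a < p ≤ b`;
the heights add up to the total difference. The multiset of heights has the same distribution as the
multiset of depths (`sum_profile_eq_sum_depthProfile`), because both obey one recursion. Removing
the first transposition `(a b)` leaves a product of two disjoint cycles, on `(a, b]` and on its
complement. There are just enough transpositions left to produce these cycles, so none joins the two
sets, and the rest is a shuffle of two minimal factorizations. If positions in the word are recorded
by labels, a shuffle is a set `S` of labels. Points of the complement keep their heights; those of
`(a, b]` gain `1` plus the height of `a + 1` in the outer factor, and as `a` varies the latter runs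
through the profile of the outer factor (`sum_factorizations_cons`). For trees, cut the edge above
the vertex `x`: a tree on `S` with root `x` splits off, the parent of `x` is marked in the rest, and
the depths in the split part are lowered by `1` plus the depth of the mark
(`sum_parentMaps_insert`).

For parking functions, fix a depth function `d`. A tree with depths `d` is an independent choice,
for each vertex `j ≠ 0`, of a parent among the vertices of depth `d j - 1`. The bounce path likewise
assigns a level to each entry, and the entries with prescribed levels range independently over
intervals of exactly these sizes (`card_fiber_eq`). The bounce is the sum of the levels
(`IsLevel.bounce_eq`). -/

/-! ### Factorizations as labelled families of pairs -/

/-- Apply the transpositions of a list of pairs one after the other. -/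
def act : List (ℕ × ℕ) → ℕ → ℕ
  | [], x => x
  | e :: s, x => act s (Equiv.swap e.1 e.2 x)

/-- The cycle `(0 1 ⋯ n)` as a map on the natural numbers. -/
def cycleMap (n x : ℕ) : ℕ := if x < n then x + 1 else if x = n then 0 else x

theorem cycleMap_of_lt {n x : ℕ} (h : x < n) : cycleMap n x = x + 1 := if_pos h

theorem cycleMap_self (n : ℕ) : cycleMap n n = 0 := by simp [cycleMap]

/-- Pairs outside `P` do not touch the image of `D` under `e`, and pairs in `P` act there as their
preimages do on `D`. Thus a shuffle of commuting parts can be evaluated one part at a time. -/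
theorem act_map_of_conj {ι : Type*} (P : ι → Prop) [DecidablePred P] (f g : ι → ℕ × ℕ)
    {e : ℕ → ℕ} (he : Function.Injective e) (D : ℕ → Prop) :
    ∀ l : List ι,
      (∀ i ∈ l, P i → f i = (e (g i).1, e (g i).2) ∧ D (g i).1 ∧ D (g i).2) →
      (∀ i ∈ l, ¬ P i → ∀ y, D y → e y ≠ (f i).1 ∧ e y ≠ (f i).2) →
      ∀ y, D y → act (l.map f) (e y) = e (act ((l.filter (P ·)).map g) y)
  | [], _, _, _, _ => rfl
  | i :: l, hin, hout, y, hy => by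
    have ih := act_map_of_conj P f g he D l (fun j hj => hin j (by simp [hj]))
      (fun j hj => hout j (by simp [hj]))
    by_cases hi : P i
    · obtain ⟨h1, h2, h3⟩ := hin i (by simp) hi
      have hD : D (Equiv.swap (g i).1 (g i).2 y) := by
        rw [Equiv.swap_apply_def]; split_ifs <;> assumption
      simp only [List.map_cons, act, hi, h1, List.filter_cons, decide_true, if_true]
      rw [← ih _ hD, he.swap_apply]
    · obtain ⟨h1, h2⟩ := hout i (by simp) hi y hy
      simp only [List.map_cons, act, hi, List.filter_cons, decide_false]
      rw [Equiv.swap_apply_of_ne_of_ne h1 h2]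
      simpa using ih y hy

/-! ### Colourings and the least number of transpositions -/

/-- A list of `k` pairs leaves at least `V.card - k` classes on `V`. -/
theorem exists_coloring (V : Finset ℕ) :
    ∀ s : List (ℕ × ℕ), ∃ c : ℕ → ℕ, (∀ e ∈ s, c e.1 = c e.2) ∧
      V.card ≤ (V.image c).card + s.length
  | [] => ⟨id, by simp, by simp⟩
  | e :: s => by
    obtain ⟨c, hc, hV⟩ := exists_coloring V s
    -- The new pair merges the colour classes of its two ends, which loses at most one colour.
    refine ⟨fun x => if c x = c e.1 then c e.2 else c x, ?_, ?_⟩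
    · intro d hd
      rcases List.mem_cons.1 hd with rfl | hd
      · by_cases h : c d.2 = c d.1 <;> simp [h]
      · simp [hc d hd]
    · have : V.image c ⊆
          insert (c e.1) (V.image fun x => if c x = c e.1 then c e.2 else c x) := by
        intro z hz
        obtain ⟨x, hx, rfl⟩ := Finset.mem_image.1 hz
        by_cases h : c x = c e.1
        · simp [h]
        · exact Finset.mem_insert_of_mem (Finset.mem_image.2 ⟨x, hx, by simp [h]⟩)
      have := (Finset.card_le_card this).trans (Finset.card_insert_le _ _)
      simp only [List.length_cons]
      omega

/-- A colouring constant on each pair is constant along the orbits of the product. -/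
theorem apply_act {c : ℕ → ℕ} :
    ∀ s : List (ℕ × ℕ), (∀ e ∈ s, c e.1 = c e.2) → ∀ x, c (act s x) = c x
  | [], _, _ => rfl
  | e :: s, h, x => by
    rw [act, apply_act s fun d hd => h d (by simp [hd])]
    have := h e (by simp)
    rw [Equiv.swap_apply_def]
    split_ifs with h1 h2
    · rw [h1, this]
    · rw [h2, this]
    · rfl

/-- A product of `k` transpositions that is a cycle of length `m + 1` has `k ≥ m`. -/
theorem le_length_of_act_eq {s : List (ℕ × ℕ)} {m : ℕ}
    (h : ∀ x ≤ m, act s x = cycleMap m x) : m ≤ s.length := by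
  obtain ⟨c, hc, hV⟩ := exists_coloring (Finset.range (m + 1)) s
  have hc0 : ∀ x ≤ m, c x = c 0 := by
    intro x
    induction x with
    | zero => simp
    | succ x ih =>
      intro hx
      rw [← ih (by omega), ← apply_act s hc x, h x (by omega), cycleMap_of_lt (by omega)]
  have : (Finset.range (m + 1)).image c ⊆ {c 0} := by
    intro z hz
    obtain ⟨x, hx, rfl⟩ := Finset.mem_image.1 hz
    simpa using hc0 x (by simpa [Nat.lt_succ_iff] using hx)
  have := Finset.card_le_card this
  simp at this hV
  omega

/-! ### Leaving out an interval -/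

/-- The increasing map that leaves out the interval `(a, a + w]`. -/
def skip (a w y : ℕ) : ℕ := if y ≤ a then y else y + w

/-- The left inverse of `skip a w`. -/
def unskip (a w y : ℕ) : ℕ := if y ≤ a then y else y - w

theorem skip_strictMono (a w : ℕ) : StrictMono (skip a w) := by
  intro x y h
  simp only [skip]
  split_ifs <;> omega

theorem unskip_skip (a w y : ℕ) : unskip a w (skip a w y) = y := by
  simp only [skip, unskip]
  split_ifs <;> omega

theorem skip_unskip {a w y : ℕ} (h : ¬ (a < y ∧ y ≤ a + w)) : skip a w (unskip a w y) = y := by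
  simp only [skip, unskip]
  split_ifs <;> omega

theorem skip_notMem (a w y : ℕ) : ¬ (a < skip a w y ∧ skip a w y ≤ a + w) := by
  simp only [skip]
  split_ifs <;> omega

/-! ### Cutting a factorization at its first transposition -/

section Factorizations

variable {ι : Type*}

/-- The number of pairs `(u, v)` with `u < p ≤ v`. -/
def height (l : List ι) (f : ι → ℕ × ℕ) (p : ℕ) : ℕ :=
  l.countP fun i => (f i).1 < p ∧ p ≤ (f i).2

/-- The multiset of the heights at `0, …, l.length`. -/
def profile (l : List ι) (f : ι → ℕ × ℕ) : Multiset ℕ :=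
  (Multiset.range (l.length + 1)).map (height l f)

variable [Fintype ι] [DecidableEq ι]

open Classical in
/-- The families of pairs `u < v`, labelled by the entries of `l`, whose transpositions, taken in
the order of `l`, multiply to the cycle `(0 1 ⋯ l.length)`. -/
def factorizations (l : List ι) : Finset (ι → ℕ × ℕ) :=
  (Fintype.piFinset fun i => if i ∈ l then
    Finset.range (l.length + 1) ×ˢ Finset.range (l.length + 1) else {(0, 0)}).filter
    fun f => (∀ i ∈ l, (f i).1 < (f i).2) ∧
      ∀ x ≤ l.length, act (l.map f) x = cycleMap l.length x

theorem mem_factorizations {l : List ι} {f : ι → ℕ × ℕ} :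
    f ∈ factorizations l ↔ (∀ i, i ∉ l → f i = (0, 0)) ∧
      (∀ i ∈ l, (f i).1 < (f i).2 ∧ (f i).2 ≤ l.length) ∧
      ∀ x ≤ l.length, act (l.map f) x = cycleMap l.length x := by
  simp only [factorizations, Finset.mem_filter, Fintype.mem_piFinset]
  constructor
  · rintro ⟨h1, h2, h3⟩
    refine ⟨fun i hi => by simpa [hi] using h1 i, fun i hi => ⟨h2 i hi, ?_⟩, h3⟩
    have := h1 i
    simp only [hi, if_true, Finset.mem_product, Finset.mem_range] at this
    omega
  · rintro ⟨h1, h2, h3⟩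
    refine ⟨fun i => ?_, fun i hi => (h2 i hi).1, h3⟩
    by_cases hi : i ∈ l
    · have := h2 i hi
      simp only [hi, if_true, Finset.mem_product, Finset.mem_range]
      omega
    · simp [hi, h1 i hi]

/-- The factorization that starts with `(a, a + w)`, followed by a shuffle of `h`, moved to the
interval `(a, a + w]`, and `g`, moved to its complement. -/
def glue (x : ι) (S : Finset ι) (a w : ℕ) (g h : ι → ℕ × ℕ) (i : ι) : ℕ × ℕ :=
  if i = x then (a, a + w) else if i ∈ S then ((h i).1 + (a + 1), (h i).2 + (a + 1))
  else (skip a w (g i).1, skip a w (g i).2)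

/-- The labels of `l` at which `f` has a pair that starts in `(a, b]`. -/
def innerLabels (l : List ι) (f : ι → ℕ × ℕ) (a b : ℕ) : Finset ι :=
  l.toFinset.filter fun i => a < (f i).1 ∧ (f i).1 ≤ b

/-- The restriction of `f` to `S`, moved from `(a, ∞)` to `[0, ∞)`. -/
def innerPart (S : Finset ι) (a : ℕ) (f : ι → ℕ × ℕ) (i : ι) : ℕ × ℕ :=
  if i ∈ S then ((f i).1 - (a + 1), (f i).2 - (a + 1)) else (0, 0)

/-- The restriction of `f` to the complement of `S` and `x`, with the interval `(a, a + w]` left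
out. -/
def outerPart (x : ι) (S : Finset ι) (a w : ℕ) (f : ι → ℕ × ℕ) (i : ι) : ℕ × ℕ :=
  if i = x ∨ i ∈ S then (0, 0) else (unskip a w (f i).1, unskip a w (f i).2)

omit [Fintype ι] in
theorem length_filter_add (l : List ι) (S : Finset ι) :
    (l.filter (· ∈ S)).length + (l.filter (· ∉ S)).length = l.length := by
  simpa using (List.length_eq_length_filter_add (l := l) (fun i => decide (i ∈ S))).symm

/-- Multiplying two disjoint cycles by a transposition that joins them gives one cycle. With `b = a
+ w`, the inner cycle closes up from `b` to `a + 1` and the outer one jumps from `a` over the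
interval; exchanging `a` and `b` first turns both into successor steps. -/
theorem glue_mem {x : ι} {l : List ι} (hx : x ∉ l) {S : Finset ι} (hS : S ⊆ l.toFinset)
    {g h : ι → ℕ × ℕ} (hg : g ∈ factorizations (l.filter (· ∉ S)))
    (hh : h ∈ factorizations (l.filter (· ∈ S))) {a : ℕ}
    (ha : a ≤ (l.filter (· ∉ S)).length) :
    glue x S a ((l.filter (· ∈ S)).length + 1) g h ∈ factorizations (x :: l) := by
  obtain ⟨g1, g2, g3⟩ := mem_factorizations.1 hg
  obtain ⟨h1, h2, h3⟩ := mem_factorizations.1 hh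
  have hlen := length_filter_add l S
  set lo := l.filter (· ∉ S) with hlo
  set li := l.filter (· ∈ S) with hli
  set m := li.length with hm
  set f := glue x S a (m + 1) g h with hf
  have fx : f x = (a, a + (m + 1)) := by simp [hf, glue]
  have fin : ∀ i ∈ l, i ∈ S → f i = ((h i).1 + (a + 1), (h i).2 + (a + 1)) := by
    intro i hi hiS
    have : i ≠ x := fun e => hx (e ▸ hi)
    simp [hf, glue, this, hiS]
  have fout : ∀ i ∈ l, i ∉ S → f i = (skip a (m + 1) (g i).1, skip a (m + 1) (g i).2) := by
    intro i hi hiS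
    have : i ≠ x := fun e => hx (e ▸ hi)
    simp [hf, glue, this, hiS]
  have hbi : ∀ i ∈ l, i ∈ S → (h i).1 < (h i).2 ∧ (h i).2 ≤ m := fun i hi hiS =>
    h2 i (by simp [hli, hi, hiS])
  have hbo : ∀ i ∈ l, i ∉ S → (g i).1 < (g i).2 ∧ (g i).2 ≤ lo.length := fun i hi hiS =>
    g2 i (by simp [hlo, hi, hiS])
  have actin : ∀ y ≤ m, act (l.map f) (y + (a + 1)) = cycleMap m y + (a + 1) := by
    intro y hy
    have := act_map_of_conj (· ∈ S) f h (e := (· + (a + 1))) (add_left_injective _) (· ≤ m) l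
      (fun i hi hiS => ⟨fin i hi hiS, by have := hbi i hi hiS; omega, (hbi i hi hiS).2⟩)
      (fun i hi hiS y hy => by
        have k1 := skip_notMem a (m + 1) (g i).1
        have k2 := skip_notMem a (m + 1) (g i).2
        rw [fout i hi hiS]
        dsimp only
        omega) y hy
    rw [← h3 y hy]
    exact this
  have actout : ∀ y ≤ lo.length, act (l.map f) (skip a (m + 1) y) =
      skip a (m + 1) (cycleMap lo.length y) := by
    intro y hy
    have := act_map_of_conj (· ∉ S) f g (e := skip a (m + 1))
      (skip_strictMono a (m + 1)).injective (fun _ => True) l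
      (fun i hi hiS => ⟨fout i hi hiS, trivial, trivial⟩)
      (fun i hi hiS y _ => by
        have k1 := skip_notMem a (m + 1) y
        rw [not_not] at hiS
        have := hbi i hi hiS
        rw [fin i hi hiS]
        dsimp only
        omega) y trivial
    rw [← g3 y hy]
    exact this
  rw [mem_factorizations]
  refine ⟨fun i hi => ?_, fun i hi => ?_, fun y hy => ?_⟩
  · simp only [List.mem_cons, not_or] at hi
    have hiS : i ∉ S := fun hiS => hi.2 (by simpa using hS hiS)
    simp [hf, glue, hi.1, hiS, g1 i (by simp [hlo, hi.2]), skip]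
  · rcases List.mem_cons.1 hi with rfl | hi
    · rw [fx]
      simp only [List.length_cons]
      omega
    · by_cases hiS : i ∈ S
      · rw [fin i hi hiS]
        have := hbi i hi hiS
        simp only [List.length_cons]
        omega
      · rw [fout i hi hiS]
        have := hbo i hi hiS
        refine ⟨skip_strictMono _ _ this.1, ?_⟩
        simp only [List.length_cons, skip]
        split_ifs <;> omega
  · simp only [List.map_cons, act, fx, List.length_cons] at hy ⊢
    rcases lt_trichotomy y a with hya | rfl | hya
    · rw [Equiv.swap_apply_of_ne_of_ne (by omega) (by omega), cycleMap_of_lt (by omega)]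
      have := actout y (by omega)
      rw [cycleMap_of_lt (by omega)] at this
      simpa [skip, hya.le, Nat.succ_le_of_lt hya] using this
    -- The point `a` is first sent to the right end of the interval, where the inner cycle returns
    -- to `a + 1`.
    · rw [Equiv.swap_apply_left, cycleMap_of_lt (by omega)]
      have := actin m le_rfl
      rw [cycleMap_self] at this
      rw [show y + (m + 1) = m + (y + 1) by omega, this]
      omega
    rcases lt_trichotomy y (a + (m + 1)) with hyb | rfl | hyb
    · rw [Equiv.swap_apply_of_ne_of_ne (by omega) (by omega), cycleMap_of_lt (by omega)]
      have := actin (y - (a + 1)) (by omega)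
      rw [cycleMap_of_lt (by omega)] at this
      rw [show y - (a + 1) + (a + 1) = y by omega] at this
      omega
    · rw [Equiv.swap_apply_right]
      have := actout a ha
      -- The right end of the interval is first sent to `a`. If `a` is the last outer point, the
      -- outer cycle returns to `0`; otherwise it goes to the first point beyond the interval.
      rcases ha.eq_or_lt with h | h
      · rw [h, cycleMap_self] at this
        rw [show a + (m + 1) = l.length + 1 by omega, cycleMap_self]
        simpa [skip, h] using this
      · rw [cycleMap_of_lt h] at this
        rw [cycleMap_of_lt (by omega)]
        simp only [skip, le_refl, if_true] at this
        rw [this, if_neg (by omega)]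
        omega
    · rw [Equiv.swap_apply_of_ne_of_ne (by omega) (by omega)]
      have := actout (y - (m + 1)) (by omega)
      rw [show skip a (m + 1) (y - (m + 1)) = y by simp only [skip]; split_ifs <;> omega] at this
      rw [this]
      simp only [skip, cycleMap]
      split_ifs <;> omega

/-- The remaining transpositions produce two cycles with as few factors as possible. A colouring
shows that no pair crosses between the cycles, and counting then gives the exact number of pairs in
each part. -/
theorem eq_glue {x : ι} {l : List ι} (hx : x ∉ l) {f : ι → ℕ × ℕ}
    (hf : f ∈ factorizations (x :: l)) {S : Finset ι}
    (hSdef : S = innerLabels l f (f x).1 (f x).2) :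
    (l.filter (· ∈ S)).length + 1 = (f x).2 - (f x).1 ∧
    (f x).1 ≤ (l.filter (· ∉ S)).length ∧
    outerPart x S (f x).1 ((f x).2 - (f x).1) f ∈ factorizations (l.filter (· ∉ S)) ∧
    innerPart S (f x).1 f ∈ factorizations (l.filter (· ∈ S)) ∧
    glue x S (f x).1 ((f x).2 - (f x).1) (outerPart x S (f x).1 ((f x).2 - (f x).1) f)
      (innerPart S (f x).1 f) = f := by
  obtain ⟨f1, f2, f3⟩ := mem_factorizations.1 hf
  have hlen := length_filter_add l S
  set lo := l.filter (· ∉ S) with hlo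
  set li := l.filter (· ∈ S) with hli
  rcases hfx : f x with ⟨a, b⟩
  have hab := f2 x (by simp)
  simp only [hfx] at hab hSdef ⊢
  obtain ⟨w, rfl⟩ : ∃ w, b = a + (w + 1) := ⟨b - a - 1, by omega⟩
  simp only [List.length_cons, List.map_cons, act, hfx] at hab f3 f2
  rw [show a + (w + 1) - a = w + 1 by omega]
  have hneg : ∀ i ∈ l, i ≠ x := fun i hi e => hx (e ▸ hi)
  have hmemS : ∀ i ∈ l, (i ∈ S ↔ a < (f i).1 ∧ (f i).1 ≤ a + (w + 1)) := by
    intro i hi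
    simp [hSdef, innerLabels, hi]
  -- Cancelling the first transposition makes the rest explicit: `a` goes where `b` went and
  -- conversely.
  have σ : ∀ y ≤ l.length + 1, act (l.map f) y =
      cycleMap (l.length + 1) (Equiv.swap a (a + (w + 1)) y) := by
    intro y hy
    have := f3 (Equiv.swap a (a + (w + 1)) y)
      (by rw [Equiv.swap_apply_def]; split_ifs <;> omega)
    rwa [Equiv.swap_apply_self] at this
  have σa : act (l.map f) a = cycleMap (l.length + 1) (a + (w + 1)) := by
    rw [σ a (by omega), Equiv.swap_apply_left]
  have σb : act (l.map f) (a + (w + 1)) = a + 1 := by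
    rw [σ _ (by omega), Equiv.swap_apply_right, cycleMap_of_lt (by omega)]
  have σo : ∀ y ≤ l.length + 1, y ≠ a → y ≠ a + (w + 1) →
      act (l.map f) y = cycleMap (l.length + 1) y := by
    intro y hy h1 h2
    rw [σ y hy, Equiv.swap_apply_of_ne_of_ne h1 h2]
  -- the interval `(a, b]` and its complement get different colours
  obtain ⟨c, hc, hV⟩ := exists_coloring (Finset.range (l.length + 2)) (l.map f)
  have hact := apply_act _ hc
  have cin : ∀ y ≤ w, c (a + 1 + y) = c (a + 1) := by
    intro y
    induction y with
    | zero => simp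
    | succ y ih =>
      intro hy
      rw [← ih (by omega), ← hact (a + 1 + y), σo _ (by omega) (by omega) (by omega),
        cycleMap_of_lt (by omega)]
      rfl
  have cout1 : ∀ y ≤ a, c y = c 0 := by
    intro y
    induction y with
    | zero => simp
    | succ y ih =>
      intro hy
      rw [← ih (by omega), ← hact y, σo _ (by omega) (by omega) (by omega),
        cycleMap_of_lt (by omega)]
  have cout2 : ∀ y, a + (w + 1) + 1 + y ≤ l.length + 1 → c (a + (w + 1) + 1 + y) = c 0 := by
    intro y
    induction y with
    | zero =>
      intro hy
      rw [← cout1 a le_rfl, ← hact a, σa, cycleMap_of_lt (by omega)]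
    | succ y ih =>
      intro hy
      rw [← ih (by omega), ← hact (a + (w + 1) + 1 + y), σo _ (by omega) (by omega) (by omega),
        cycleMap_of_lt (by omega)]
      rfl
  have hcin : ∀ y, a < y → y ≤ a + (w + 1) → c y = c (a + 1) := by
    intro y h1 h2
    have := cin (y - (a + 1)) (by omega)
    rwa [show a + 1 + (y - (a + 1)) = y by omega] at this
  have hcout : ∀ y ≤ l.length + 1, ¬ (a < y ∧ y ≤ a + (w + 1)) → c y = c 0 := by
    intro y hy h
    by_cases hya : y ≤ a
    · exact cout1 y hya
    · have := cout2 (y - (a + (w + 1) + 1)) (by omega)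
      rwa [show a + (w + 1) + 1 + (y - (a + (w + 1) + 1)) = y by omega] at this
  -- There are `l.length + 2` points and `l.length` pairs, so at least two colours survive.
  have hne : c (a + 1) ≠ c 0 := by
    intro h
    have : (Finset.range (l.length + 2)).image c ⊆ {c 0} := by
      intro z hz
      obtain ⟨y, hy, rfl⟩ := Finset.mem_image.1 hz
      simp only [Finset.mem_range, Finset.mem_singleton] at hy ⊢
      by_cases hya : a < y ∧ y ≤ a + (w + 1)
      · rw [hcin y hya.1 hya.2, h]
      · exact hcout y (by omega) hya
    have := Finset.card_le_card this
    simp at this hV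
    omega
  have hbd : ∀ i ∈ l, (f i).1 < (f i).2 ∧ (f i).2 ≤ l.length + 1 := fun i hi =>
    f2 i (by simp [hi])
  have hsep : ∀ i ∈ l, ((a < (f i).1 ∧ (f i).1 ≤ a + (w + 1)) ↔
      (a < (f i).2 ∧ (f i).2 ≤ a + (w + 1))) := by
    intro i hi
    have h1 := hc (f i) (List.mem_map_of_mem hi)
    have h2 := hbd i hi
    constructor
    · intro h
      by_contra h'
      rw [hcin _ h.1 h.2, hcout _ (by omega) h'] at h1
      exact hne h1
    · intro h
      by_contra h'
      rw [hcin _ h.1 h.2, hcout _ (by omega) h'] at h1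
      exact hne h1.symm
  set g := outerPart x S a (w + 1) f with hg
  set h := innerPart S a f with hh
  have gi : ∀ i ∈ l, i ∉ S → f i = (skip a (w + 1) (g i).1, skip a (w + 1) (g i).2) := by
    intro i hi hiS
    have k := mt (hmemS i hi).2 hiS
    simp only [hg, outerPart, hneg i hi, hiS, or_self, if_false]
    rw [skip_unskip k, skip_unskip (mt (hsep i hi).2 k)]
  have hhi : ∀ i ∈ l, i ∈ S → f i = ((h i).1 + (a + 1), (h i).2 + (a + 1)) := by
    intro i hi hiS
    have k := (hmemS i hi).1 hiS
    have k' := (hsep i hi).1 k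
    simp only [hh, innerPart, hiS, if_true]
    ext <;> dsimp only <;> omega
  have hib : ∀ i ∈ l, i ∈ S → (h i).1 < (h i).2 ∧ (h i).2 ≤ w := by
    intro i hi hiS
    have k := (hmemS i hi).1 hiS
    have k' := (hsep i hi).1 k
    have k2 := hbd i hi
    rw [hhi i hi hiS] at k k' k2
    dsimp only at k k' k2
    omega
  have actin : ∀ y ≤ w, act (li.map h) y = cycleMap w y := by
    intro y hy
    have := act_map_of_conj (· ∈ S) f h (e := (· + (a + 1))) (add_left_injective _) (· ≤ w) l
      (fun i hi hiS => ⟨hhi i hi hiS, by have := hib i hi hiS; omega, (hib i hi hiS).2⟩)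
      (fun i hi hiS y hy => by
        have k1 := mt (hmemS i hi).2 hiS
        have k2 := mt (hsep i hi).2 k1
        omega) y hy
    have h3 : act (l.map f) (y + (a + 1)) = act (li.map h) y + (a + 1) := this
    rcases hy.eq_or_lt with rfl | hy
    · rw [show y + (a + 1) = a + (y + 1) by omega, σb] at h3
      rw [cycleMap_self]
      omega
    · rw [σo _ (by omega) (by omega) (by omega), cycleMap_of_lt (by omega)] at h3
      rw [cycleMap_of_lt hy]
      omega
  have actout : ∀ y ≤ l.length - w, act (lo.map g) y = cycleMap (l.length - w) y := by
    intro y hy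
    have := act_map_of_conj (· ∉ S) f g (e := skip a (w + 1))
      (skip_strictMono a (w + 1)).injective (fun _ => True) l
      (fun i hi hiS => ⟨gi i hi hiS, trivial, trivial⟩)
      (fun i hi hiS y _ => by
        have k := skip_notMem a (w + 1) y
        rw [not_not] at hiS
        have k1 := (hmemS i hi).1 hiS
        have k2 := (hsep i hi).1 k1
        omega) y trivial
    have h3 : act (l.map f) (skip a (w + 1) y) = skip a (w + 1) (act (lo.map g) y) := this
    apply (skip_strictMono a (w + 1)).injective
    rw [← h3]
    rcases lt_trichotomy y a with hya | rfl | hya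
    · rw [show skip a (w + 1) y = y by simp [skip, hya.le], σo y (by omega) (by omega) (by omega),
        cycleMap_of_lt (by omega), cycleMap_of_lt (by omega)]
      simp [skip, Nat.succ_le_of_lt hya]
    · rw [show skip y (w + 1) y = y by simp [skip], σa]
      simp only [skip, cycleMap]
      split_ifs <;> omega
    · rw [show skip a (w + 1) y = y + (w + 1) by simp [skip, hya.not_ge],
        σo _ (by omega) (by omega) (by omega)]
      simp only [skip, cycleMap]
      split_ifs <;> omega
  -- The two lower bounds `w` and `l.length - w` add up to the number of pairs available, so both
  -- are attained.
  have l1 := le_length_of_act_eq actin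
  have l2 := le_length_of_act_eq actout
  rw [List.length_map] at l1 l2
  have e1 : li.length = w := by omega
  have e2 : lo.length = l.length - w := by omega
  refine ⟨by omega, by omega, ?_, ?_, ?_⟩
  · rw [mem_factorizations, e2]
    refine ⟨fun i hi => ?_, fun i hi => ?_, actout⟩
    · by_cases hix : i = x ∨ i ∈ S
      · simp [hg, outerPart, hix]
      · have : i ∉ x :: l := by
          rw [not_or] at hix
          simp only [hlo, List.mem_filter, decide_not] at hi
          simp only [List.mem_cons, not_or]
          exact ⟨hix.1, fun h => hi ⟨h, by simp [hix.2]⟩⟩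
        simp [hg, outerPart, hix, f1 i this, unskip]
    · simp only [hlo, List.mem_filter, decide_eq_true_eq] at hi
      have k := hbd i hi.1
      rw [gi i hi.1 hi.2] at k
      refine ⟨(skip_strictMono a (w + 1)).lt_iff_lt.1 k.1, ?_⟩
      have := k.2
      simp only [skip] at this
      split_ifs at this <;> omega
  · rw [mem_factorizations, e1]
    refine ⟨fun i hi => ?_, fun i hi => ?_, actin⟩
    · have : i ∉ S := fun hiS => hi (by
        have : i ∈ l := by
          rw [hSdef] at hiS
          simpa using (Finset.mem_filter.1 hiS).1
        simp [hli, this, hiS])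
      simp [hh, innerPart, this]
    · simp only [hli, List.mem_filter, decide_eq_true_eq] at hi
      exact hib i hi.1 hi.2
  · funext i
    by_cases hix : i = x
    · simp [glue, hix, hfx]
    by_cases hi : i ∈ l
    · by_cases hiS : i ∈ S
      · simp [glue, hix, hiS, ← hhi i hi hiS]
      · simp [glue, hix, hiS, ← gi i hi hiS]
    · have hiS : i ∉ S := fun hiS => hi (by
        rw [hSdef] at hiS
        simpa using (Finset.mem_filter.1 hiS).1)
      have : f i = (0, 0) := f1 i (by simp [hix, hi])
      simp [glue, hix, hiS, hg, outerPart, this, skip, unskip]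

end Factorizations

/-! ### Heights and the recursion for factorizations -/

section FactorizationRecursion

variable {ι : Type*} [DecidableEq ι]

theorem height_cons (x : ι) (l : List ι) (S : Finset ι) (f : ι → ℕ × ℕ) (p : ℕ) :
    height (x :: l) f p = height (l.filter (· ∈ S)) f p + height (l.filter (· ∉ S)) f p +
      if (f x).1 < p ∧ p ≤ (f x).2 then 1 else 0 := by
  simp only [height, List.countP_cons, decide_eq_true_eq]
  congr 1
  simpa using List.countP_eq_countP_filter_add l
    (fun i => decide ((f i).1 < p ∧ p ≤ (f i).2)) (fun i => decide (i ∈ S))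

omit [DecidableEq ι] in
theorem height_congr {l : List ι} {f g : ι → ℕ × ℕ} {p q : ℕ}
    (h : ∀ i ∈ l, ((f i).1 < p ∧ p ≤ (f i).2) ↔ ((g i).1 < q ∧ q ≤ (g i).2)) :
    height l f p = height l g q :=
  List.countP_congr fun i hi => by simpa using h i hi

omit [DecidableEq ι] in
theorem height_eq_zero {l : List ι} {f : ι → ℕ × ℕ} {p : ℕ}
    (h : ∀ i ∈ l, ¬ ((f i).1 < p ∧ p ≤ (f i).2)) : height l f p = 0 := by
  simpa [height, List.countP_eq_zero] using h

theorem range_eq_map_skip_add {a k m : ℕ} (ha : a ≤ k) :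
    Multiset.range (m + k + 2) = (Multiset.range (k + 1)).map (skip a (m + 1)) +
      (Multiset.range (m + 1)).map (· + (a + 1)) := by
  refine (Multiset.Nodup.ext (Multiset.nodup_range _) ?_).2 fun y => ?_
  · refine Multiset.nodup_add.2 ⟨(Multiset.nodup_range _).map (skip_strictMono _ _).injective,
      (Multiset.nodup_range _).map (add_left_injective _), ?_⟩
    rw [Multiset.disjoint_left]
    intro y hy hy'
    obtain ⟨z, -, rfl⟩ := Multiset.mem_map.1 hy
    obtain ⟨z', hz', h⟩ := Multiset.mem_map.1 hy'
    have := skip_notMem a (m + 1) z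
    rw [Multiset.mem_range] at hz'
    omega
  · simp only [Multiset.mem_range, Multiset.mem_add, Multiset.mem_map]
    constructor
    · intro hy
      by_cases h : a < y ∧ y ≤ a + (m + 1)
      · exact Or.inr ⟨y - (a + 1), by omega, by omega⟩
      · refine Or.inl ⟨unskip a (m + 1) y, ?_, skip_unskip h⟩
        simp only [unskip]
        split_ifs <;> omega
    · rintro (⟨z, hz, rfl⟩ | ⟨z, hz, rfl⟩)
      · simp only [skip]
        split_ifs <;> omega
      · omega

variable [Fintype ι]

/-- At an outer position neither the first pair nor any inner pair counts. At an inner position the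
first pair counts once, the inner pairs count as in `h`, and the outer pairs that count are those
spanning the whole interval, that is, those of `g` that count at `a + 1`. -/
theorem profile_glue {x : ι} {l : List ι} (hx : x ∉ l) {S : Finset ι}
    {g h : ι → ℕ × ℕ} (hh : h ∈ factorizations (l.filter (· ∈ S))) {a : ℕ}
    (ha : a ≤ (l.filter (· ∉ S)).length) :
    profile (x :: l) (glue x S a ((l.filter (· ∈ S)).length + 1) g h) =
      profile (l.filter (· ∉ S)) g + (profile (l.filter (· ∈ S)) h).map
        (· + (height (l.filter (· ∉ S)) g (a + 1) + 1)) := by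
  obtain ⟨h1, h2, -⟩ := mem_factorizations.1 hh
  have hlen := length_filter_add l S
  set lo := l.filter (· ∉ S) with hlo
  set li := l.filter (· ∈ S) with hli
  set m := li.length with hm
  set f := glue x S a (m + 1) g h with hf
  have fx : f x = (a, a + (m + 1)) := by simp [hf, glue]
  have fin : ∀ i ∈ li, f i = ((h i).1 + (a + 1), (h i).2 + (a + 1)) := by
    intro i hi
    obtain ⟨hi, hiS⟩ : i ∈ l ∧ i ∈ S := by simpa [hli] using hi
    have : i ≠ x := fun e => hx (e ▸ hi)
    simp [hf, glue, this, hiS]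
  have fout : ∀ i ∈ lo, f i = (skip a (m + 1) (g i).1, skip a (m + 1) (g i).2) := by
    intro i hi
    obtain ⟨hi, hiS⟩ : i ∈ l ∧ i ∉ S := by simpa [hlo] using hi
    have : i ≠ x := fun e => hx (e ▸ hi)
    simp [hf, glue, this, hiS]
  simp only [profile, List.length_cons]
  rw [show l.length + 1 + 1 = m + lo.length + 2 by omega, range_eq_map_skip_add ha,
    Multiset.map_add, Multiset.map_map, Multiset.map_map, Multiset.map_map]
  congr 1
  · refine Multiset.map_congr rfl fun y hy => ?_
    have k := skip_notMem a (m + 1) y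
    simp only [Function.comp_apply]
    rw [height_cons x l S, fx, if_neg k, ← hlo, ← hli, add_zero, height_eq_zero (l := li), zero_add]
    · refine height_congr fun i hi => ?_
      rw [fout i hi]
      simp only [(skip_strictMono a (m + 1)).lt_iff_lt, (skip_strictMono a (m + 1)).le_iff_le]
    · intro i hi
      rw [fin i hi]
      have := h2 i hi
      dsimp only
      omega
  · refine Multiset.map_congr rfl fun y hy => ?_
    rw [Multiset.mem_range] at hy
    simp only [Function.comp_apply]
    rw [height_cons x l S, fx, if_pos (by dsimp only; omega), ← hlo, ← hli, add_assoc]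
    refine congrArg₂ _ ?_ (congrArg (· + 1) ?_)
    · refine height_congr fun i hi => ?_
      rw [fin i hi]
      dsimp only
      omega
    · refine height_congr fun i hi => ?_
      rw [fout i hi]
      simp only [skip]
      split_ifs <;> omega

/-- The heights at `0` and at `l.length + 1` both vanish, so shifting the range by one does not
change the multiset of heights. -/
theorem sum_height_succ {M : Type*} [AddCommMonoid M] {l : List ι} {g : ι → ℕ × ℕ}
    (hg : g ∈ factorizations l) (K : ℕ → M) :
    ∑ a ∈ Finset.range (l.length + 1), K (height l g (a + 1)) =
      ((profile l g).map K).sum := by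
  obtain ⟨-, h2, -⟩ := mem_factorizations.1 hg
  have e : ((profile l g).map K).sum =
      ∑ a ∈ Finset.range (l.length + 1), K (height l g a) := by
    simp only [profile, Multiset.map_map]
    rfl
  rw [e, Finset.sum_range_succ, Finset.sum_range_succ', height_eq_zero, height_eq_zero]
  · intro i hi
    omega
  · intro i hi
    have := h2 i hi
    omega

theorem innerLabels_glue {x : ι} {l : List ι} (hx : x ∉ l) {S : Finset ι}
    (hS : S ⊆ l.toFinset) {g h : ι → ℕ × ℕ} (hh : h ∈ factorizations (l.filter (· ∈ S))) (a : ℕ) :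
    innerLabels l (glue x S a ((l.filter (· ∈ S)).length + 1) g h) a
      (a + ((l.filter (· ∈ S)).length + 1)) = S := by
  obtain ⟨-, h2, -⟩ := mem_factorizations.1 hh
  ext i
  simp only [innerLabels, Finset.mem_filter, List.mem_toFinset]
  constructor
  · rintro ⟨hi, h⟩
    by_contra hiS
    have : i ≠ x := fun e => hx (e ▸ hi)
    simp only [glue, this, hiS, if_false] at h
    exact skip_notMem _ _ _ h
  · intro hiS
    have hi : i ∈ l := by simpa using hS hiS
    have : i ≠ x := fun e => hx (e ▸ hi)
    have := h2 i (by simp [hi, hiS])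
    refine ⟨hi, ?_⟩
    simp only [glue, ‹i ≠ x›, hiS, if_false, if_true]
    omega

theorem outerPart_glue {x : ι} {l : List ι} (hx : x ∉ l) {S : Finset ι}
    {g h : ι → ℕ × ℕ} (hg : g ∈ factorizations (l.filter (· ∉ S))) (a w : ℕ) :
    outerPart x S a w (glue x S a w g h) = g := by
  obtain ⟨h1, -, -⟩ := mem_factorizations.1 hg
  funext i
  by_cases hi : i = x ∨ i ∈ S
  · rw [h1 i (by rcases hi with rfl | hi <;> simp [*])]
    simp [outerPart, hi]
  · simp only [outerPart, hi, if_false]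
    rw [not_or] at hi
    simp [glue, hi.1, hi.2, unskip_skip]

theorem innerPart_glue {x : ι} {l : List ι} (hx : x ∉ l) {S : Finset ι} (hS : S ⊆ l.toFinset)
    {g h : ι → ℕ × ℕ} (hh : h ∈ factorizations (l.filter (· ∈ S))) (a w : ℕ) :
    innerPart S a (glue x S a w g h) = h := by
  obtain ⟨h1, -, -⟩ := mem_factorizations.1 hh
  funext i
  by_cases hi : i ∈ S
  · have : i ≠ x := fun e => hx (e ▸ by simpa using hS hi)
    simp [innerPart, glue, hi, this]
  · rw [h1 i (by simp [hi])]
    simp [innerPart, hi]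

/-- Removing the first transposition `(a b)` of a factorization of a cycle leaves a shuffle of
factorizations of the cycle on `(a, b]` and of the cycle on its complement. -/
theorem sum_factorizations_cons {M : Type*} [AddCommMonoid M] {x : ι} {l : List ι} (hx : x ∉ l)
    (G : Multiset ℕ → M) :
    ∑ f ∈ factorizations (x :: l), G (profile (x :: l) f) =
      ∑ S ∈ l.toFinset.powerset, ∑ g ∈ factorizations (l.filter (· ∉ S)),
        ((profile (l.filter (· ∉ S)) g).map fun d =>
          ∑ h ∈ factorizations (l.filter (· ∈ S)),
            G (profile (l.filter (· ∉ S)) g +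
              (profile (l.filter (· ∈ S)) h).map (· + (d + 1)))).sum := by
  symm
  calc _ = ∑ S ∈ l.toFinset.powerset, ∑ g ∈ factorizations (l.filter (· ∉ S)),
        ∑ a ∈ Finset.range ((l.filter (· ∉ S)).length + 1),
          ∑ h ∈ factorizations (l.filter (· ∈ S)),
            G (profile (l.filter (· ∉ S)) g +
              (profile (l.filter (· ∈ S)) h).map
                (· + (height (l.filter (· ∉ S)) g (a + 1) + 1))) :=
        Finset.sum_congr rfl fun S _ => Finset.sum_congr rfl fun g hg =>
          (sum_height_succ hg _).symm
    _ = _ := by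
      simp only [Finset.sum_sigma']
      refine Finset.sum_bij'
        (fun q _ => glue x q.1 q.2.2.1 ((l.filter (· ∈ q.1)).length + 1) q.2.1 q.2.2.2)
        (fun f _ => ⟨innerLabels l f (f x).1 (f x).2,
          outerPart x (innerLabels l f (f x).1 (f x).2) (f x).1 ((f x).2 - (f x).1) f,
          (f x).1, innerPart (innerLabels l f (f x).1 (f x).2) (f x).1 f⟩) ?_ ?_ ?_ ?_ ?_
      · rintro ⟨S, g, a, h⟩ hq
        simp only [Finset.mem_sigma, Finset.mem_powerset, Finset.mem_range] at hq
        exact glue_mem hx hq.1 hq.2.1 hq.2.2.2 (Nat.lt_succ_iff.1 hq.2.2.1)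
      · intro f hf
        obtain ⟨-, k2, k3, k4, -⟩ := eq_glue hx hf rfl
        simp only [Finset.mem_sigma, Finset.mem_powerset, Finset.mem_range]
        exact ⟨Finset.filter_subset _ _, k3, by omega, k4⟩
      · rintro ⟨S, g, a, h⟩ hq
        simp only [Finset.mem_sigma, Finset.mem_powerset, Finset.mem_range] at hq
        have fx : glue x S a ((l.filter (· ∈ S)).length + 1) g h x =
            (a, a + ((l.filter (· ∈ S)).length + 1)) := by simp [glue]
        simp only [fx, innerLabels_glue hx hq.1 hq.2.2.2, add_tsub_cancel_left,
          outerPart_glue hx hq.2.1, innerPart_glue hx hq.1 hq.2.2.2]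
      · intro f hf
        obtain ⟨k1, -, -, -, k5⟩ := eq_glue hx hf rfl
        dsimp only
        rw [k1]
        exact k5
      · rintro ⟨S, g, a, h⟩ hq
        simp only [Finset.mem_sigma, Finset.mem_powerset, Finset.mem_range] at hq
        dsimp only
        rw [profile_glue hx hq.2.2.2 (Nat.lt_succ_iff.1 hq.2.2.1)]

end FactorizationRecursion

/-! ### Rooted trees as parent maps -/

section ParentMaps

variable {ι : Type*} [DecidableEq ι]

/-- `d` is the depth function of the tree with root `r`, other vertices `L` and parent map `p`. -/
def IsDepth (r : ι) (L : Finset ι) (p : ι → ι) (d : ι → ℕ) : Prop :=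
  d r = 0 ∧ ∀ j ∈ L, p j ∈ insert r L ∧ d j = d (p j) + 1

/-- The depth also bounds how often the parent map can be applied before the root is reached, so
induction on its value determines it. In particular its existence excludes cycles of parents. -/
theorem IsDepth.eq {r : ι} {L : Finset ι} {p : ι → ι} {d d' : ι → ℕ} (h : IsDepth r L p d)
    (h' : IsDepth r L p d') : ∀ j ∈ insert r L, d j = d' j := by
  have : ∀ k, ∀ j ∈ insert r L, d j = k → d' j = k := by
    intro k
    induction k with
    | zero =>
      intro j hj hk
      rcases Finset.mem_insert.1 hj with rfl | hj
      · exact h'.1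
      · have := (h.2 j hj).2
        omega
    | succ k ih =>
      intro j hj hk
      rcases Finset.mem_insert.1 hj with rfl | hj
      · have := h.1
        omega
      · have e := (h.2 j hj).2
        have e' := (h'.2 j hj).2
        have := ih (p j) (h.2 j hj).1 (by omega)
        omega
  exact fun j hj => (this _ j hj rfl).symm

open Classical in
/-- The depth of the vertices of a tree. -/
def depth (r : ι) (L : Finset ι) (p : ι → ι) : ι → ℕ :=
  if h : ∃ d, IsDepth r L p d then h.choose else 0

theorem IsDepth.depth {r : ι} {L : Finset ι} {p : ι → ι} {d : ι → ℕ} (h : IsDepth r L p d) :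
    IsDepth r L p (depth r L p) := by
  have h : ∃ d, IsDepth r L p d := ⟨d, h⟩
  rw [DepthBounce.depth, dif_pos h]
  exact h.choose_spec

/-- The multiset of the depths of the vertices. -/
def depthProfile (r : ι) (L : Finset ι) (p : ι → ι) : Multiset ℕ :=
  (insert r L).val.map (depth r L p)

theorem IsDepth.depthProfile_eq {r : ι} {L : Finset ι} {p : ι → ι} {d : ι → ℕ}
    (h : IsDepth r L p d) : depthProfile r L p = (insert r L).val.map d :=
  Multiset.map_congr rfl fun _ hj => h.depth.eq h _ hj

variable [Fintype ι]

open Classical in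
/-- The parent maps of the trees with root `r` and other vertices `L`. -/
def parentMaps (r : ι) (L : Finset ι) : Finset (ι → ι) :=
  Finset.univ.filter fun p => (∀ j, j ∉ L → p j = j) ∧ ∃ d, IsDepth r L p d

theorem mem_parentMaps {r : ι} {L : Finset ι} {p : ι → ι} :
    p ∈ parentMaps r L ↔ (∀ j, j ∉ L → p j = j) ∧ IsDepth r L p (depth r L p) := by
  simp only [parentMaps, Finset.mem_filter, Finset.mem_univ, true_and]
  exact and_congr_right fun _ => ⟨fun ⟨_, h⟩ => h.depth, fun h => ⟨_, h⟩⟩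

/-- Attach a tree `h` with root `x` and other vertices `S` to the vertex `v` of the tree `g`. -/
def graft (x : ι) (S : Finset ι) (v : ι) (g h : ι → ι) (j : ι) : ι :=
  if j = x then v else if j ∈ S then h j else g j

open Classical in
/-- The vertices of `L` from which the map `p` leads to `x`. -/
def descendants (x : ι) (L : Finset ι) (p : ι → ι) : Finset ι :=
  L.filter fun j => ∃ k, p^[k] j = x

omit [DecidableEq ι] [Fintype ι] in
theorem descendants_subset (x : ι) (L : Finset ι) (p : ι → ι) : descendants x L p ⊆ L := by
  classical exact Finset.filter_subset _ _

/-- The map that agrees with `p` on `S` and fixes all other points. -/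
def restrict (S : Finset ι) (p : ι → ι) (j : ι) : ι := if j ∈ S then p j else j

omit [Fintype ι] in
theorem isDepth_graft {x r : ι} {L S : Finset ι} (hx : x ∉ L) (hxr : x ≠ r) (hr : r ∉ L)
    (hS : S ⊆ L) {v : ι} (hv : v ∈ insert r (L \ S)) {g h : ι → ι} {d e : ι → ℕ}
    (hg : IsDepth r (L \ S) g d) (hh : IsDepth x S h e) :
    IsDepth r (insert x L) (graft x S v g h)
      fun j => if j ∈ insert x S then e j + (d v + 1) else d j := by
  have hrS : r ∉ insert x S := by
    simp only [Finset.mem_insert, not_or]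
    exact ⟨hxr.symm, fun h => hr (hS h)⟩
  have hout : ∀ j ∈ insert r (L \ S), j ∉ insert x S := by
    intro j hj
    rcases Finset.mem_insert.1 hj with rfl | hj
    · exact hrS
    · rw [Finset.mem_sdiff] at hj
      simp only [Finset.mem_insert, not_or]
      exact ⟨fun h => hx (h ▸ hj.1), hj.2⟩
  refine ⟨by simp only [hrS, if_false, hg.1], fun j hj => ?_⟩
  rcases Finset.mem_insert.1 hj with rfl | hj
  · have hj1 : graft j S v g h j = v := by simp [graft]
    refine ⟨?_, ?_⟩
    · rw [hj1]
      simp only [Finset.mem_insert, Finset.mem_sdiff] at hv ⊢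
      tauto
    · simp only [hj1, Finset.mem_insert_self, if_true, hh.1, hout v hv, if_false, zero_add]
  have hjx : j ≠ x := fun h => hx (h ▸ hj)
  by_cases hjS : j ∈ S
  · have hj1 : graft x S v g h j = h j := by simp [graft, hjx, hjS]
    have k := hh.2 j hjS
    refine ⟨?_, ?_⟩
    · rw [hj1]
      have := k.1
      simp only [Finset.mem_insert] at this ⊢
      exact this.elim (fun h => .inr (.inl h)) fun h => .inr (.inr (hS h))
    · simp only [hj1, k.1, Finset.mem_insert_of_mem hjS, if_true, k.2]
      omega
  · have hj1 : graft x S v g h j = g j := by simp [graft, hjx, hjS]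
    have hj' : j ∈ L \ S := Finset.mem_sdiff.2 ⟨hj, hjS⟩
    have k := hg.2 j hj'
    refine ⟨?_, ?_⟩
    · rw [hj1]
      have := k.1
      simp only [Finset.mem_insert, Finset.mem_sdiff] at this ⊢
      tauto
    · simp only [hj1, hout _ k.1, hout _ (Finset.mem_insert_of_mem hj'), if_false, k.2]

-- The vertices outside the grafted tree are closed under the parent map and never reach `x`; inside
-- it the depth `e` decreases until `x` is reached.
omit [Fintype ι] in
theorem descendants_graft {x r : ι} {L S : Finset ι} (hx : x ∉ L) (hxr : x ≠ r)
    (hS : S ⊆ L) {v : ι} {g h : ι → ι} (hr : g r = r) {d e : ι → ℕ}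
    (hg : IsDepth r (L \ S) g d) (hh : IsDepth x S h e) (hrS : r ∉ L) :
    descendants x L (graft x S v g h) = S := by
  ext j
  simp only [descendants, Finset.mem_filter]
  constructor
  · rintro ⟨hj, k, hk⟩
    by_contra hjS
    have : ∀ k, ∀ j ∈ insert r (L \ S), (graft x S v g h)^[k] j ∈ insert r (L \ S) := by
      intro k
      induction k with
      | zero => simp
      | succ k ih =>
        intro j hj
        rw [Function.iterate_succ_apply]
        apply ih
        rcases Finset.mem_insert.1 hj with rfl | hj
        · have : j ∉ S := fun h => hrS (hS h)
          simp [graft, hxr.symm, this, hr]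
        · have hj' := Finset.mem_sdiff.1 hj
          have hjx : j ≠ x := fun h => hx (h ▸ hj'.1)
          simp only [graft, hjx, hj'.2, if_false]
          exact (hg.2 j hj).1
    have := this k j (by simp [hj, hjS])
    rw [hk] at this
    simp [hxr, hx] at this
  · intro hjS
    refine ⟨hS hjS, ?_⟩
    have : ∀ k, ∀ j ∈ insert x S, e j = k → ∃ k, (graft x S v g h)^[k] j = x := by
      intro k
      induction k with
      | zero =>
        intro j hj hk
        rcases Finset.mem_insert.1 hj with rfl | hj
        · exact ⟨0, rfl⟩
        · have := (hh.2 j hj).2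
          omega
      | succ k ih =>
        intro j hj hk
        rcases Finset.mem_insert.1 hj with rfl | hj
        · exact ⟨0, rfl⟩
        · have e1 := hh.2 j hj
          obtain ⟨n, hn⟩ := ih (h j) e1.1 (by omega)
          refine ⟨n + 1, ?_⟩
          have hjx : j ≠ x := fun h => hx (h ▸ hS hj)
          rw [Function.iterate_succ_apply,
            show graft x S v g h j = h j by simp [graft, hjx, hj], hn]
    exact this _ j (Finset.mem_insert_of_mem hjS) rfl

theorem depthProfile_graft {x r : ι} {L S : Finset ι} (hx : x ∉ L) (hxr : x ≠ r) (hr : r ∉ L)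
    (hS : S ⊆ L) {v : ι} (hv : v ∈ insert r (L \ S)) {g h : ι → ι}
    (hg : g ∈ parentMaps r (L \ S)) (hh : h ∈ parentMaps x S) :
    depthProfile r (insert x L) (graft x S v g h) = depthProfile r (L \ S) g +
      (depthProfile x S h).map (· + (depth r (L \ S) g v + 1)) := by
  have hg := (mem_parentMaps.1 hg).2
  have hh := (mem_parentMaps.1 hh).2
  rw [(isDepth_graft hx hxr hr hS hv hg hh).depthProfile_eq]
  have hd : Disjoint (insert r (L \ S)) (insert x S) := by
    rw [Finset.disjoint_left]
    intro j hj hj'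
    simp only [Finset.mem_insert, Finset.mem_sdiff] at hj hj'
    rcases hj with rfl | hj <;> rcases hj' with rfl | hj'
    · exact hxr rfl
    · exact hr (hS hj')
    · exact hx hj.1
    · exact hj.2 hj'
  have hU : insert r (insert x L) = (insert r (L \ S)).disjUnion (insert x S) hd := by
    ext j
    have := @hS j
    simp only [Finset.disjUnion_eq_union, Finset.mem_union, Finset.mem_insert, Finset.mem_sdiff]
    tauto
  rw [hU]
  simp only [Finset.disjUnion, Multiset.map_add, depthProfile, Multiset.map_map]
  congr 1
  · refine Multiset.map_congr rfl fun j hj => ?_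
    rw [if_neg]
    exact fun h => Finset.disjoint_left.1 hd hj h
  · refine Multiset.map_congr rfl fun j hj => ?_
    rw [if_pos (show j ∈ insert x S from hj)]
    rfl

omit [Fintype ι] in
theorem depth_le_of_iterate_eq {x r : ι} {L : Finset ι} {p : ι → ι} {d : ι → ℕ}
    (h : IsDepth r L p d) (hp : ∀ j, j ∉ L → p j = j) :
    ∀ k j, p^[k] j = x → d x ≤ d j := by
  intro k
  induction k with
  | zero => rintro j rfl; rfl
  | succ k ih =>
    intro j hk
    rw [Function.iterate_succ_apply] at hk
    have := ih _ hk
    by_cases hj : j ∈ L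
    · have := (h.2 j hj).2
      omega
    · rwa [hp j hj] at this

/-- The depth does not increase towards the root. So the parent of `x`, being less deep than `x`, is
not a descendant of `x`, and the mark lies in the rest. -/
theorem split_parentMap {x r : ι} {L : Finset ι} (hx : x ∉ L) (hxr : x ≠ r) (hr : r ∉ L)
    {p : ι → ι} (hp : p ∈ parentMaps r (insert x L)) {S : Finset ι}
    (hS : S = descendants x L p) :
    p x ∈ insert r (L \ S) ∧ restrict (L \ S) p ∈ parentMaps r (L \ S) ∧
      restrict S p ∈ parentMaps x S := by
  obtain ⟨h1, h2⟩ := mem_parentMaps.1 hp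
  set d := depth r (insert x L) p
  have hmemS : ∀ j, j ∈ S ↔ j ∈ L ∧ ∃ k, p^[k] j = x := by
    intro j
    simp [hS, descendants]
  have hle := fun k j => depth_le_of_iterate_eq (x := x) h2 h1 k j
  have hx' := h2.2 x (by simp)
  have hiter : ∀ k, p^[k] r = r := by
    intro k
    exact Function.iterate_fixed (h1 r (by simp [hxr.symm, hr])) k
  refine ⟨?_, ?_, ?_⟩
  · have k := hx'.1
    simp only [Finset.mem_insert, Finset.mem_sdiff, hmemS] at k ⊢
    rcases k with k | k | k
    · exact .inl k
    · rw [k] at hx'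
      omega
    · refine .inr ⟨k, ?_⟩
      rintro ⟨-, n, hn⟩
      have := hle n _ hn
      omega
  · simp only [parentMaps, Finset.mem_filter, Finset.mem_univ, true_and]
    refine ⟨fun j hj => by simp [restrict, hj], d, h2.1, fun j hj => ?_⟩
    simp only [restrict, hj, if_true]
    have hj' := Finset.mem_sdiff.1 hj
    have k := h2.2 j (by simp [hj'.1])
    refine ⟨?_, k.2⟩
    have hn : ∀ n, p^[n] (p j) ≠ x := fun n hn =>
      hj'.2 ((hmemS j).2 ⟨hj'.1, n + 1, by rwa [Function.iterate_succ_apply]⟩)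
    have k := k.1
    simp only [Finset.mem_insert, Finset.mem_sdiff, hmemS] at k ⊢
    rcases k with k | k | k
    · exact .inl k
    · exact absurd k (hn 0)
    · exact .inr ⟨k, fun ⟨_, n, h⟩ => hn n h⟩
  · simp only [parentMaps, Finset.mem_filter, Finset.mem_univ, true_and]
    -- Depth relative to `x`; the subtraction is not truncated on `S`, since descendants of `x` are
    -- at least as deep as `x`.
    refine ⟨fun j hj => by simp [restrict, hj], fun j => d j - d x, by simp, fun j hj => ?_⟩
    simp only [restrict, hj, if_true]
    obtain ⟨hjL, n, hn⟩ := (hmemS j).1 hj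
    obtain _ | n := n
    · exact absurd hjL ((show j = x from hn) ▸ hx)
    rw [Function.iterate_succ_apply] at hn
    have k := h2.2 j (by simp [hjL])
    have := hle n _ hn
    refine ⟨?_, by omega⟩
    have k := k.1
    simp only [Finset.mem_insert, hmemS] at k ⊢
    rcases k with k | k | k
    · rw [k, hiter] at hn
      exact absurd hn.symm hxr
    · exact .inl k
    · exact .inr ⟨k, n, hn⟩

/-- Removing the edge above the vertex `x` splits a tree into the subtree with root `x` and the
rest, in which the parent of `x` is marked. -/
theorem sum_parentMaps_insert {M : Type*} [AddCommMonoid M] {x r : ι} {L : Finset ι}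
    (hx : x ∉ L) (hxr : x ≠ r) (hr : r ∉ L) (G : Multiset ℕ → M) :
    ∑ p ∈ parentMaps r (insert x L), G (depthProfile r (insert x L) p) =
      ∑ S ∈ L.powerset, ∑ g ∈ parentMaps r (L \ S),
        ((depthProfile r (L \ S) g).map fun d => ∑ h ∈ parentMaps x S,
          G (depthProfile r (L \ S) g + (depthProfile x S h).map (· + (d + 1)))).sum := by
  symm
  calc _ = ∑ S ∈ L.powerset, ∑ g ∈ parentMaps r (L \ S), ∑ v ∈ insert r (L \ S),
        ∑ h ∈ parentMaps x S, G (depthProfile r (L \ S) g +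
          (depthProfile x S h).map (· + (depth r (L \ S) g v + 1))) := by
        refine Finset.sum_congr rfl fun S _ => Finset.sum_congr rfl fun g _ => ?_
        rw [depthProfile, Multiset.map_map]
        rfl
    _ = _ := by
      simp only [Finset.sum_sigma']
      refine Finset.sum_bij' (fun q _ => graft x q.1 q.2.2.1 q.2.1 q.2.2.2)
        (fun p _ => ⟨descendants x L p, restrict (L \ descendants x L p) p, p x,
          restrict (descendants x L p) p⟩) ?_ ?_ ?_ ?_ ?_
      · rintro ⟨S, g, v, h⟩ hq
        simp only [Finset.mem_sigma, Finset.mem_powerset] at hq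
        obtain ⟨hS, hg, hv, hh⟩ := hq
        obtain ⟨g1, g2⟩ := mem_parentMaps.1 hg
        obtain ⟨h1, h2⟩ := mem_parentMaps.1 hh
        simp only [parentMaps, Finset.mem_filter, Finset.mem_univ, true_and]
        refine ⟨fun j hj => ?_, _, isDepth_graft hx hxr hr hS hv g2 h2⟩
        simp only [Finset.mem_insert, not_or] at hj
        have : j ∉ S := fun h => hj.2 (hS h)
        simp [graft, hj.1, this, g1 j (by simp [hj.2])]
      · intro p hp
        obtain ⟨k1, k2, k3⟩ := split_parentMap hx hxr hr hp rfl
        simp only [Finset.mem_sigma, Finset.mem_powerset]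
        exact ⟨descendants_subset _ _ _, k2, k1, k3⟩
      · rintro ⟨S, g, v, h⟩ hq
        simp only [Finset.mem_sigma, Finset.mem_powerset] at hq
        obtain ⟨hS, hg, hv, hh⟩ := hq
        obtain ⟨g1, g2⟩ := mem_parentMaps.1 hg
        obtain ⟨h1, h2⟩ := mem_parentMaps.1 hh
        have e1 : descendants x L (graft x S v g h) = S :=
          descendants_graft hx hxr hS (g1 r (by simp [hr])) g2 h2 hr
        have e2 : restrict (L \ S) (graft x S v g h) = g := by
          funext j
          by_cases hj : j ∈ L \ S
          · have hj' := Finset.mem_sdiff.1 hj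
            have : j ≠ x := fun h => hx (h ▸ hj'.1)
            simp [restrict, hj'.1, hj'.2, graft, this]
          · simp [restrict, hj, g1 j hj]
        have e3 : restrict S (graft x S v g h) = h := by
          funext j
          by_cases hj : j ∈ S
          · have : j ≠ x := fun h => hx (h ▸ hS hj)
            simp [restrict, hj, graft, this]
          · simp [restrict, hj, h1 j hj]
        have e4 : graft x S v g h x = v := by simp [graft]
        simp only [e1, e2, e3, e4]
      · intro p hp
        obtain ⟨h1, -⟩ := mem_parentMaps.1 hp
        funext j
        dsimp only
        by_cases hjx : j = x
        · simp [graft, hjx]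
        by_cases hj : j ∈ L
        · by_cases hjS : j ∈ descendants x L p
          · simp [graft, hjx, hjS, restrict]
          · simp [graft, hjx, hjS, restrict, hj]
        · have hjS : j ∉ descendants x L p := fun h => hj (descendants_subset _ _ _ h)
          simp [graft, hjx, hjS, restrict, hj, h1 j (by simp [hjx, hj])]
      · rintro ⟨S, g, v, h⟩ hq
        simp only [Finset.mem_sigma, Finset.mem_powerset] at hq
        obtain ⟨hS, hg, hv, hh⟩ := hq
        dsimp only
        rw [depthProfile_graft hx hxr hr hS hv hg hh]

end ParentMaps

/-! ### Factorizations and trees -/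

/-- Height profiles of factorizations and depth profiles of trees have the same distribution. -/
theorem sum_profile_eq_sum_depthProfile {ι M : Type*} [Fintype ι] [DecidableEq ι]
    [AddCommMonoid M] (n : ℕ) : ∀ (l : List ι) (r : ι) (G : Multiset ℕ → M), l.length = n →
      l.Nodup → r ∉ l → ∑ f ∈ factorizations l, G (profile l f) =
        ∑ p ∈ parentMaps r l.toFinset, G (depthProfile r l.toFinset p) := by
  induction n using Nat.strong_induction_on with
  | _ n ih =>
    intro l r G hn hl hr
    rcases l with _ | ⟨x, l⟩
    · have e1 : factorizations ([] : List ι) = {fun _ => (0, 0)} := by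
        ext f
        simp [mem_factorizations, act, cycleMap, funext_iff]
      have d0 : IsDepth r (∅ : Finset ι) id fun _ => 0 := ⟨rfl, by simp⟩
      have e2 : parentMaps r (∅ : Finset ι) = {id} := by
        ext p
        simp only [mem_parentMaps, Finset.notMem_empty, not_false_eq_true, forall_const,
          Finset.mem_singleton]
        refine ⟨fun h => funext h.1, ?_⟩
        rintro rfl
        exact ⟨fun _ => rfl, d0.depth⟩
      simp [e1, e2, d0.depthProfile_eq, profile, height]
    · obtain ⟨hx, hl⟩ := List.nodup_cons.1 hl
      obtain ⟨hrx, hr⟩ := not_or.1 (mt List.mem_cons.2 hr)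
      rw [List.toFinset_cons, sum_factorizations_cons hx,
        sum_parentMaps_insert (by simpa using hx) (Ne.symm hrx) (by simpa using hr)]
      refine Finset.sum_congr rfl fun S hS => ?_
      rw [Finset.mem_powerset] at hS
      have hlen := length_filter_add l S
      simp only [List.length_cons] at hn
      have ti : (l.filter (· ∈ S)).toFinset = S := by
        ext j
        have := @hS j
        simp only [List.mem_toFinset] at this
        simpa using this
      have t_out : (l.filter (· ∉ S)).toFinset = l.toFinset \ S := by
        ext j
        simp
      -- For the outer part, the whole sum over inner parts serves as the function of the profile.
      -- This is why the induction is over arbitrary `G`.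
      have k1 := ih (l.filter (· ∉ S)).length (by omega) (l.filter (· ∉ S)) r
        (fun μ => (μ.map fun d => ∑ h ∈ factorizations (l.filter (· ∈ S)),
          G (μ + (profile (l.filter (· ∈ S)) h).map (· + (d + 1)))).sum) rfl
        (hl.filter _) (fun h => hr (List.mem_of_mem_filter h))
      rw [k1, t_out]
      refine Finset.sum_congr rfl fun g _ => ?_
      congr 1
      refine Multiset.map_congr rfl fun d _ => ?_
      -- The inner part becomes a tree with root `x`, so the root must also vary in the induction.
      have k2 := ih (l.filter (· ∈ S)).length (by omega) (l.filter (· ∈ S)) x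
        (fun μ => G (depthProfile r (l.toFinset \ S) g + μ.map (· + (d + 1)))) rfl
        (hl.filter _) (fun h => hx (List.mem_of_mem_filter h))
      rw [k2, ti]

/-- Double counting: the pair `(u, v)` counts at the `v - u` points of `(u, v]`. -/
theorem sum_height {ι : Type*} {N : ℕ} {f : ι → ℕ × ℕ} : ∀ l : List ι,
    (∀ i ∈ l, (f i).2 ≤ N) →
      ∑ p ∈ Finset.range (N + 1), height l f p = (l.map fun i => (f i).2 - (f i).1).sum
  | [], _ => by simp [height]
  | i :: l, h => by
    have ih := sum_height l fun j hj => h j (by simp [hj])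
    have hi := h i (by simp)
    have e : ((Finset.range (N + 1)).filter fun p => (f i).1 < p ∧ p ≤ (f i).2) =
        Finset.Ioc (f i).1 (f i).2 := by
      ext p
      simp only [Finset.mem_filter, Finset.mem_range, Finset.mem_Ioc]
      omega
    simp only [height, List.countP_cons, decide_eq_true_eq, Finset.sum_add_distrib,
      List.map_cons, List.sum_cons, Finset.sum_boole, e, Nat.card_Ioc] at ih ⊢
    rw [ih, add_comm]
    rfl

/-! ### Sequences of transpositions as families of pairs -/

section MinimalFactorizations

variable {n : ℕ}

theorem eq_swap_lower_upper {τ : Equiv.Perm (Fin (n + 1))} (h : τ.IsSwap) :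
    lower τ < upper τ ∧ τ = Equiv.swap (lower τ) (upper τ) := by
  obtain ⟨a, b, hab, rfl⟩ := h
  rcases hab.lt_or_gt with h | h
  · rw [lower_swap h, upper_swap h]
    exact ⟨h, rfl⟩
  · rw [Equiv.swap_comm, lower_swap h, upper_swap h]
    exact ⟨h, rfl⟩

/-- The elements moved by a transposition. -/
def movedPair (τ : Equiv.Perm (Fin (n + 1))) : ℕ × ℕ := (lower τ, upper τ)

theorem act_map_movedPair : ∀ s : List (Equiv.Perm (Fin (n + 1))), (∀ τ ∈ s, τ.IsSwap) →
    ∀ x : Fin (n + 1), act (s.map movedPair) x = s.reverse.prod x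
  | [], _, _ => rfl
  | τ :: s, h, x => by
    have e := (eq_swap_lower_upper (h τ (by simp))).2
    simp only [List.map_cons, act, List.reverse_cons, List.prod_append, List.prod_singleton,
      Equiv.Perm.mul_apply]
    rw [← act_map_movedPair s (fun σ hσ => h σ (by simp [hσ])) (τ x)]
    congr 1
    conv_rhs => rw [e]
    exact Fin.val_injective.swap_apply _ _ _

theorem val_finRotate (x : Fin (n + 1)) : (finRotate (n + 1) x : ℕ) = cycleMap n x := by
  rcases eq_or_ne x (Fin.last n) with rfl | h
  · simp [cycleMap_self]
  · rw [coe_finRotate_of_ne_last h, cycleMap_of_lt (Fin.val_lt_last h)]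

theorem leftToRightProd_eq_iff {t : Fin n → Equiv.Perm (Fin (n + 1))} (ht : ∀ i, (t i).IsSwap) :
    leftToRightProd t = finRotate (n + 1) ↔
      ∀ x ≤ n, act ((List.ofFn t).map movedPair) x = cycleMap n x := by
  have hs : ∀ τ ∈ List.ofFn t, τ.IsSwap := by
    intro τ hτ
    obtain ⟨i, rfl⟩ := (List.mem_ofFn' _ _).1 hτ
    exact ht i
  constructor
  · intro h x hx
    have := act_map_movedPair _ hs ⟨x, Nat.lt_succ_of_le hx⟩
    rw [← leftToRightProd, h, val_finRotate] at this
    exact this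
  · intro h
    ext x
    rw [leftToRightProd, ← act_map_movedPair _ hs, val_finRotate, h x (Nat.lt_succ_iff.1 x.2)]

/-- The family of pairs of a sequence of transpositions; the label `0` is not used. -/
def pairFamily (t : Fin n → Equiv.Perm (Fin (n + 1))) : Fin (n + 1) → ℕ × ℕ :=
  Fin.cons (0, 0) fun i => movedPair (t i)

/-- The sequence of transpositions of a family of pairs. -/
def swapFamily (f : Fin (n + 1) → ℕ × ℕ) (i : Fin n) : Equiv.Perm (Fin (n + 1)) :=
  Equiv.swap (Fin.ofNat (n + 1) (f i.succ).1) (Fin.ofNat (n + 1) (f i.succ).2)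

/-- The list of the vertices other than the root. -/
def nonRoots (n : ℕ) : List (Fin (n + 1)) := (List.finRange n).map Fin.succ

theorem mem_nonRoots {i : Fin (n + 1)} : i ∈ nonRoots n ↔ i ≠ 0 := by
  simp [nonRoots, Fin.exists_succ_eq]

theorem length_nonRoots : (nonRoots n).length = n := by simp [nonRoots]

theorem map_pairFamily (t : Fin n → Equiv.Perm (Fin (n + 1))) :
    (nonRoots n).map (pairFamily t) = (List.ofFn t).map movedPair := by
  simp [nonRoots, List.ofFn_eq_map, pairFamily, Function.comp_def]

theorem movedPair_swapFamily {f : Fin (n + 1) → ℕ × ℕ} {i : Fin n}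
    (h : (f i.succ).1 < (f i.succ).2 ∧ (f i.succ).2 ≤ n) :
    movedPair (swapFamily f i) = f i.succ ∧ (swapFamily f i).IsSwap := by
  -- `Fin.ofNat` reduces modulo `n + 1`, which changes nothing for entries at most `n`.
  have e1 : (f i.succ).1 % (n + 1) = (f i.succ).1 := Nat.mod_eq_of_lt (by omega)
  have e2 : (f i.succ).2 % (n + 1) = (f i.succ).2 := Nat.mod_eq_of_lt (by omega)
  have hlt : Fin.ofNat (n + 1) (f i.succ).1 < Fin.ofNat (n + 1) (f i.succ).2 := by
    rw [Fin.lt_def, Fin.val_ofNat, Fin.val_ofNat, e1, e2]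
    exact h.1
  refine ⟨?_, _, _, hlt.ne, rfl⟩
  rw [movedPair, swapFamily, lower_swap hlt, upper_swap hlt, Fin.val_ofNat, Fin.val_ofNat, e1, e2]

theorem sum_profile_pairFamily (t : Fin n → Equiv.Perm (Fin (n + 1))) :
    (profile (nonRoots n) (pairFamily t)).sum = totalDifference t := by
  have := sum_height (N := n) (f := pairFamily t) (nonRoots n) (by
    intro i hi
    obtain ⟨j, rfl⟩ := Fin.exists_succ_eq.2 (mem_nonRoots.1 hi)
    exact Nat.lt_succ_iff.1 (upper (t j)).2)
  rw [profile, length_nonRoots, totalDifference]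
  refine Eq.trans this ?_
  simp only [nonRoots, List.map_map, Fin.sum_univ_def]
  rfl

theorem sum_minimalFactorizations {M : Type*} [AddCommMonoid M] (F : ℕ → M) :
    ∑ t ∈ minimalFactorizations n, F (totalDifference t) =
      ∑ f ∈ factorizations (nonRoots n), F (profile (nonRoots n) f).sum := by
  refine Finset.sum_bij' (fun t _ => pairFamily t) (fun f _ => swapFamily f) ?_ ?_ ?_ ?_ ?_
  · intro t ht
    simp only [minimalFactorizations, Finset.mem_filter, Finset.mem_univ, true_and] at ht
    rw [mem_factorizations]
    refine ⟨fun i hi => ?_, fun i hi => ?_, ?_⟩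
    · rw [mem_nonRoots, not_not] at hi
      subst hi
      rfl
    · obtain ⟨j, rfl⟩ := Fin.exists_succ_eq.2 (mem_nonRoots.1 hi)
      rw [length_nonRoots]
      exact ⟨(eq_swap_lower_upper (ht.1 j)).1, Nat.lt_succ_iff.1 (upper (t j)).2⟩
    · rw [length_nonRoots, map_pairFamily]
      exact (leftToRightProd_eq_iff ht.1).1 ht.2
  · intro f hf
    obtain ⟨-, h2, h3⟩ := mem_factorizations.1 hf
    rw [length_nonRoots] at h2 h3
    have k := fun i : Fin n => movedPair_swapFamily (h2 i.succ (mem_nonRoots.2 i.succ_ne_zero))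
    simp only [minimalFactorizations, Finset.mem_filter, Finset.mem_univ, true_and]
    refine ⟨fun i => (k i).2, (leftToRightProd_eq_iff fun i => (k i).2).2 ?_⟩
    convert h3 using 4
    simp only [nonRoots, List.ofFn_eq_map, List.map_map]
    exact List.map_congr_left fun i _ => (k i).1
  · intro t ht
    simp only [minimalFactorizations, Finset.mem_filter, Finset.mem_univ, true_and] at ht
    funext i
    have := (eq_swap_lower_upper (ht.1 i)).2
    simp only [swapFamily, pairFamily, Fin.cons_succ, movedPair]
    rw [Fin.ofNat_val_eq_self, Fin.ofNat_val_eq_self]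
    exact this.symm
  · intro f hf
    obtain ⟨h1, h2, -⟩ := mem_factorizations.1 hf
    rw [length_nonRoots] at h2
    funext i
    refine Fin.cases ?_ (fun i => ?_) i
    · exact (h1 0 (by simp [mem_nonRoots])).symm
    · exact (movedPair_swapFamily (h2 i.succ (mem_nonRoots.2 i.succ_ne_zero))).1
  · intro t _
    rw [sum_profile_pairFamily]

end MinimalFactorizations

/-! ### Labelled trees and parent maps -/

section Trees

variable {V : Type*} [Fintype V] [DecidableEq V]

/-- The graph with the edges `{j, p j}`. -/
def parentGraph (p : V → V) : SimpleGraph V := SimpleGraph.fromRel fun i j => p i = j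

omit [Fintype V] [DecidableEq V] in
theorem parentGraph_adj {p : V → V} {i j : V} :
    (parentGraph p).Adj i j ↔ i ≠ j ∧ (p i = j ∨ p j = i) := SimpleGraph.fromRel_adj _ _ _

variable {r : V} {p : V → V} {d : V → ℕ}

theorem IsDepth.depth_eq (h : IsDepth r (Finset.univ.erase r) p d) :
    DepthBounce.depth r (Finset.univ.erase r) p = d := by
  funext j
  exact h.depth.eq h j (by simp [Finset.insert_erase])

theorem parentMaps_univ_erase : p ∈ parentMaps r (Finset.univ.erase r) ↔
    p r = r ∧ ∃ d : V → ℕ, d r = 0 ∧ ∀ j, j ≠ r → d j = d (p j) + 1 := by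
  simp only [parentMaps, Finset.mem_filter, Finset.mem_univ, true_and]
  simp [IsDepth, Finset.insert_erase]

omit [Fintype V] [DecidableEq V] in
theorem parentGraph_adj_parent (h : ∀ j, j ≠ r → d j = d (p j) + 1) {j : V} (hj : j ≠ r) :
    (parentGraph p).Adj j (p j) := by
  refine parentGraph_adj.2 ⟨fun e => ?_, Or.inl rfl⟩
  have := h j hj
  rw [← e] at this
  omega

omit [Fintype V] [DecidableEq V] in
theorem exists_walk_length_eq (h0 : d r = 0) (h : ∀ j, j ≠ r → d j = d (p j) + 1) (k : ℕ) :
    ∀ j, d j = k → ∃ w : (parentGraph p).Walk r j, w.length = k := by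
  induction k with
  | zero =>
    intro j hj
    have : j = r := by
      by_contra hjr
      have := h j hjr
      omega
    subst this
    exact ⟨.nil, rfl⟩
  | succ k ih =>
    intro j hj
    have hjr : j ≠ r := by
      rintro rfl
      omega
    obtain ⟨w, hw⟩ := ih (p j) (by have := h j hjr; omega)
    exact ⟨w.concat (parentGraph_adj_parent h hjr).symm, by simp [hw]⟩

omit [Fintype V] [DecidableEq V] in
theorem le_add_length (hr : p r = r) (h : ∀ j, j ≠ r → d j = d (p j) + 1) {i j : V}
    (w : (parentGraph p).Walk i j) : d j ≤ d i + w.length := by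
  induction w with
  | nil => simp
  | @cons a b c hab w ih =>
    have : d b ≤ d a + 1 := by
      rcases (parentGraph_adj.1 hab).2 with e | e
      · by_cases ha : a = r
        · rw [← e, ha, hr]
          omega
        · have := h a ha
          rw [e] at this
          omega
      · by_cases hb : b = r
        · rw [← e, hb, hr]
          omega
        · have := h b hb
          rw [e] at this
          omega
    rw [SimpleGraph.Walk.length_cons]
    omega

omit [Fintype V] [DecidableEq V] in
theorem parentGraph_connected (h0 : d r = 0) (h : ∀ j, j ≠ r → d j = d (p j) + 1) :
    (parentGraph p).Connected := by
  have hreach : ∀ j, (parentGraph p).Reachable r j := fun j =>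
    ⟨(exists_walk_length_eq h0 h _ j rfl).choose⟩
  have : Nonempty V := ⟨r⟩
  exact ⟨fun i j => (hreach i).symm.trans (hreach j)⟩

omit [Fintype V] [DecidableEq V] in
theorem parentGraph_dist (hr : p r = r) (h0 : d r = 0) (h : ∀ j, j ≠ r → d j = d (p j) + 1)
    (j : V) : (parentGraph p).dist r j = d j := by
  apply le_antisymm
  · obtain ⟨w, hw⟩ := exists_walk_length_eq h0 h _ j rfl
    rw [← hw]
    exact SimpleGraph.dist_le w
  · obtain ⟨w, hw⟩ := (parentGraph_connected h0 h).exists_walk_length_eq_dist r j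
    have := le_add_length hr h w
    omega

/-- A connected graph is a tree once it has fewer edges than vertices, and every edge here joins
some `j ≠ r` to its parent. -/
theorem parentGraph_isTree (hr : p r = r) (h0 : d r = 0) (h : ∀ j, j ≠ r → d j = d (p j) + 1) :
    (parentGraph p).IsTree := by
  have hc := parentGraph_connected h0 h
  refine SimpleGraph.isTree_iff_connected_and_card.2
    ⟨hc, le_antisymm ?_ hc.card_vert_le_card_edgeSet_add_one⟩
  have : (parentGraph p).edgeSet ⊆
      ((Finset.univ.erase r).image fun j => s(j, p j) : Finset (Sym2 V)) := by
    intro e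
    induction e with
    | _ i j =>
      rw [SimpleGraph.mem_edgeSet, parentGraph_adj]
      simp only [Finset.coe_image, Set.mem_image, Finset.mem_coe, Finset.mem_erase,
        Finset.mem_univ, and_true]
      rintro ⟨hij, e | e⟩
      · refine ⟨i, ?_, by rw [e]⟩
        rintro rfl
        exact hij (hr.symm.trans e)
      · refine ⟨j, ?_, by rw [e, Sym2.eq_swap]⟩
        rintro rfl
        exact hij (e.symm.trans hr)
  have k := Nat.card_mono (Finset.finite_toSet _) this
  have k2 := Finset.card_image_le (s := Finset.univ.erase r) (f := fun j => s(j, p j))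
  rw [Nat.card_eq_card_toFinset (SetLike.coe _), Finset.toFinset_coe] at k
  rw [Finset.card_erase_of_mem (Finset.mem_univ _), Finset.card_univ] at k2
  have : 0 < Fintype.card V := Fintype.card_pos_iff.2 ⟨r⟩
  rw [Nat.card_eq_fintype_card (α := V)]
  omega

/-- The graph determines the depths as distances from `r`, and these orient each edge towards the
root. -/
theorem parentGraph_injOn :
    Set.InjOn parentGraph (parentMaps r (Finset.univ.erase r) : Set (V → V)) := by
  intro p hp p' hp' e
  obtain ⟨hr, d, h0, h⟩ := parentMaps_univ_erase.1 (Finset.mem_coe.1 hp)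
  obtain ⟨hr', d', h0', h'⟩ := parentMaps_univ_erase.1 (Finset.mem_coe.1 hp')
  obtain rfl : d = d' := by
    funext j
    rw [← parentGraph_dist hr h0 h, e, parentGraph_dist hr' h0' h']
  funext j
  by_cases hj : j = r
  · rw [hj, hr, hr']
  · have k := parentGraph_adj_parent h hj
    rw [e, parentGraph_adj] at k
    rcases k.2 with k | k
    · exact k.symm
    · have h1 := h j hj
      by_cases hpj : p j = r
      · rw [hpj, hr'] at k
        exact absurd k.symm hj
      · have h2 := h' _ hpj
        rw [k] at h2
        omega

/-- Let the parent be the next vertex on a shortest path to `r`. The resulting graph is connected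
and contained in `T`, and trees are minimal connected graphs. -/
theorem exists_parentGraph_eq {T : SimpleGraph V} (hT : T.IsTree) (r : V) :
    ∃ p ∈ parentMaps r (Finset.univ.erase r), parentGraph p = T := by
  have key : ∀ j, ∃ i, (j = r → i = r) ∧ (j ≠ r → T.Adj j i ∧ T.dist r j = T.dist r i + 1) := by
    intro j
    by_cases hj : j = r
    · exact ⟨r, by simp [hj]⟩
    obtain ⟨w, hw⟩ := hT.connected.exists_walk_length_eq_dist j r
    cases w with
    | nil => exact absurd rfl hj
    | @cons _ i _ hji w =>
      refine ⟨i, fun h => absurd h hj, fun _ => ⟨hji, ?_⟩⟩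
      have h1 := SimpleGraph.dist_le w
      rw [SimpleGraph.Walk.length_cons] at hw
      rw [SimpleGraph.dist_comm (u := j)] at hw
      rw [SimpleGraph.dist_comm (u := i)] at h1
      rcases hT.dist_eq_dist_add_one_of_adj r hji with h | h <;> omega
  choose p hp1 hp2 using key
  have hr := hp1 r rfl
  have h := fun j hj => (hp2 j hj).2
  refine ⟨p, parentMaps_univ_erase.2 ⟨hr, _, SimpleGraph.dist_self, h⟩, ?_⟩
  have hle : parentGraph p ≤ T := by
    intro i j hij
    obtain ⟨hij, e | e⟩ := parentGraph_adj.1 hij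
    · rw [← e]
      exact (hp2 i fun hi => hij (by rw [← e, hi, hr])).1
    · rw [← e]
      exact (hp2 j fun hj => hij (by rw [← e, hj, hr])).1.symm
  exact (SimpleGraph.isTree_iff_minimal_connected.1 hT).eq_of_le
    (parentGraph_connected SimpleGraph.dist_self h) hle

end Trees

variable {n : ℕ}

theorem sum_labelledTrees {M : Type*} [AddCommMonoid M] (F : ℕ → M) :
    ∑ T ∈ labelledTrees n, F (totalDepth T) =
      ∑ p ∈ parentMaps 0 (Finset.univ.erase (0 : Fin (n + 1))),
        F (depthProfile 0 (Finset.univ.erase 0) p).sum := by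
  symm
  refine Finset.sum_bij (fun p _ => parentGraph p) ?_ ?_ ?_ ?_
  · intro p hp
    obtain ⟨hr, d, h0, h⟩ := parentMaps_univ_erase.1 hp
    simpa [labelledTrees] using parentGraph_isTree hr h0 h
  · intro p hp p' hp' e
    exact parentGraph_injOn hp hp' e
  · intro T hT
    obtain ⟨p, hp, e⟩ := exists_parentGraph_eq (T := T) (by simpa [labelledTrees] using hT) 0
    exact ⟨p, hp, e⟩
  · intro p hp
    have h1 := (mem_parentMaps.1 hp).2
    obtain ⟨hr, -⟩ := parentMaps_univ_erase.1 hp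
    congr 1
    rw [depthProfile, Finset.insert_erase (Finset.mem_univ _), totalDepth]
    exact Finset.sum_congr rfl fun j _ =>
      (parentGraph_dist hr h1.1 (fun i hi => (h1.2 i (by simp [hi])).2) j).symm

/-! ### Ancestors, inversions and coinversions -/

theorem card_isDescendant {T : SimpleGraph (Fin (n + 1))} (hT : T.IsTree) (j : Fin (n + 1))
    [DecidablePred fun i => IsDescendant T i j] :
    (Finset.univ.filter fun i => IsDescendant T i j).card = T.dist 0 j := by
  obtain ⟨w, hw, hl⟩ := hT.connected.exists_path_of_dist j 0
  have : (Finset.univ.filter fun i => IsDescendant T i j) = w.support.toFinset.erase j := by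
    ext i
    rw [Finset.mem_filter, Finset.mem_erase, List.mem_toFinset, IsDescendant]
    simp only [Finset.mem_univ, true_and]
    refine and_congr_right fun _ => ⟨?_, fun hi => ⟨w, hw, hi⟩⟩
    rintro ⟨w', hw', hi⟩
    rwa [(hT.existsUnique_path j 0).unique hw hw']
  rw [this, Finset.card_erase_of_mem (by simp), List.toFinset_card_of_nodup hw.support_nodup,
    SimpleGraph.Walk.length_support, hl, SimpleGraph.dist_comm, Nat.add_sub_cancel]

theorem inv_add_coinv {T : SimpleGraph (Fin (n + 1))} (hT : T.IsTree) :
    inv T + coinv T = totalDepth T := by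
  classical
  have e : inv T + coinv T = (Finset.univ.filter fun ij : Fin (n + 1) × Fin (n + 1) =>
      IsDescendant T ij.1 ij.2).card := by
    rw [inv, coinv, ← Finset.card_union_of_disjoint]
    · congr 1
      ext ij
      simp only [Finset.mem_union, Finset.mem_filter, Finset.mem_univ, true_and,
        ← and_or_left, and_iff_left_iff_imp]
      exact fun h => h.1.lt_or_gt.symm
    · rw [Finset.disjoint_left]
      intro ij h1 h2
      exact lt_asymm (Finset.mem_filter.1 h1).2.2 (Finset.mem_filter.1 h2).2.2
  rw [e, Finset.card_filter, Fintype.sum_prod_type_right, totalDepth]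
  exact Finset.sum_congr rfl fun j _ => by rw [← Finset.card_filter, card_isDescendant hT]

/-! ### Parking functions -/

section Parking

variable {n : ℕ}

/-- The number of entries that are at most `i`. -/
def countLE (a : Fin n → ℕ) (i : ℕ) : ℕ := (Finset.univ.filter fun j => a j ≤ i).card

theorem countLE_mono (a : Fin n → ℕ) : Monotone (countLE a) := fun _ _ h =>
  Finset.card_le_card (Finset.monotone_filter_right _ fun _ _ h' => le_trans h' h)

theorem countLE_le (a : Fin n → ℕ) (i : ℕ) : countLE a i ≤ n :=
  (Finset.card_le_univ _).trans_eq (Fintype.card_fin n)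

theorem rearrangement_le_iff (a : Fin n → ℕ) (x : Fin n) (i : ℕ) :
    rearrangement a x ≤ i ↔ x < countLE a i := by
  have : countLE a i = (Finset.univ.filter fun j => rearrangement a j ≤ i).card := by
    refine Finset.card_bij' (fun j _ => (Tuple.sort a).symm j) (fun j _ => Tuple.sort a j)
      ?_ ?_ ?_ ?_ <;> simp only [Finset.mem_filter, Finset.mem_univ, true_and] <;>
      simp [rearrangement]
  rw [this]
  exact (Tuple.lt_card_le_iff_apply_le_of_monotone (Tuple.monotone_sort a)).symm

theorem isParkingFunction_iff {a : Fin n → ℕ} :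
    IsParkingFunction a ↔ ∀ i < n, i < countLE a i :=
  ⟨fun h i hi => (rearrangement_le_iff a ⟨i, hi⟩ i).1 (h ⟨i, hi⟩),
    fun h i => (rearrangement_le_iff a i i).2 (h i i.2)⟩

/-! ### The bouncing ball -/

/-- The abscissa of the ball on the diagonal after `k` bounces. -/
def front (a : Fin n → ℕ) : ℕ → ℕ
  | 0 => 0
  | k + 1 => countLE a (front a k)

theorem front_le (a : Fin n → ℕ) : ∀ k, front a k ≤ n
  | 0 => n.zero_le
  | _ + 1 => countLE_le _ _

theorem front_mono (a : Fin n → ℕ) : Monotone (front a) := by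
  refine monotone_nat_of_le_succ fun k => ?_
  induction k with
  | zero => exact Nat.zero_le _
  | succ k ih => exact countLE_mono a ih

theorem front_lt_succ {a : Fin n → ℕ} (ha : IsParkingFunction a) {k : ℕ} (hk : front a k < n) :
    front a k < front a (k + 1) := isParkingFunction_iff.1 ha _ hk

theorem le_front {a : Fin n → ℕ} (ha : IsParkingFunction a) (k : ℕ) : min k n ≤ front a k := by
  induction k with
  | zero => simp
  | succ k ih =>
    rcases (front_le a k).lt_or_eq with h | h
    · have := front_lt_succ ha h
      omega
    · have := front_mono a (Nat.le_add_right k 1)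
      omega

theorem stepHeight_le_iff (a : Fin n → ℕ) (x : ℕ) {i : ℕ} (hi : i < n) :
    stepHeight a x ≤ i ↔ x < countLE a i := by
  rw [stepHeight]
  split_ifs with h
  · exact rearrangement_le_iff a ⟨x, h⟩ i
  · have := countLE_le a i
    omega

/-- The path rises from height `i` exactly once, after the horizontal steps at heights at most `i`.
So a ball at `(i, i)` bounces to abscissa `countLE a i`. -/
theorem hasVerticalStep_iff (a : Fin n → ℕ) (x : ℕ) {i : ℕ} (hi : i < n) :
    HasVerticalStep a x i ↔ x = countLE a i := by
  have h1 := stepHeight_le_iff a (x - 1) hi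
  have h2 := stepHeight_le_iff a x hi
  have := countLE_le a i
  rw [HasVerticalStep, h1]
  omega

theorem meetsDiagonal_iff {a : Fin n → ℕ} (ha : IsParkingFunction a) (x : ℕ) :
    MeetsDiagonal a x ↔ ∃ k, front a k = x := by
  constructor
  · intro h
    induction h with
    | start => exact ⟨0, rfl⟩
    | bounce _ hin hx ih =>
      obtain ⟨k, rfl⟩ := ih
      exact ⟨k + 1, ((hasVerticalStep_iff a _ hin).1 hx.1.2).symm⟩
  · rintro ⟨k, rfl⟩
    induction k with
    | zero => exact .start
    | succ k ih =>
      rcases (front_le a k).lt_or_eq with h | h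
      · refine .bounce ih h ⟨⟨(front_lt_succ ha h).le, (hasVerticalStep_iff a _ h).2 rfl⟩, ?_⟩
        rintro x ⟨-, hx⟩
        exact ((hasVerticalStep_iff a _ h).1 hx).ge
      · have : front a (k + 1) = front a k :=
          le_antisymm ((front_le a (k + 1)).trans_eq h.symm) (front_mono a (Nat.le_add_right k 1))
        rwa [this]

/-- The ball advances strictly until it reaches `n`, within `n` bounces. Diagonal points before `n`
are therefore counted once each, and the repeated value `n` contributes nothing. -/
theorem bounce_eq_sum {a : Fin n → ℕ} (ha : IsParkingFunction a) {K : ℕ} (hK : n ≤ K) :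
    DepthBounce.bounce a = ∑ k ∈ Finset.range K, (n - front a k) := by
  classical
  have hinj : Set.InjOn (front a) ((Finset.range K).filter fun k => front a k < n : Finset ℕ) := by
    intro k hk k' hk' e
    simp only [Finset.coe_filter, Set.mem_ofPred_eq] at hk hk'
    by_contra hne
    rcases lt_or_gt_of_ne hne with h | h
    · have := front_lt_succ ha hk.2
      have := front_mono a (Nat.add_one_le_iff.2 h)
      omega
    · have := front_lt_succ ha hk'.2
      have := front_mono a (Nat.add_one_le_iff.2 h)
      omega
  have e1 : ∑ k ∈ Finset.range K, (n - front a k) =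
      ∑ k ∈ (Finset.range K).filter (fun k => front a k < n), (n - front a k) := by
    refine (Finset.sum_filter_of_ne fun k _ h => ?_).symm
    omega
  rw [e1, ← Finset.sum_image (f := fun i => n - i) hinj, DepthBounce.bounce]
  symm
  apply Finset.sum_subset
  · intro x hx
    simp only [Finset.mem_image, Finset.mem_filter, Finset.mem_range] at hx ⊢
    obtain ⟨k, hk, rfl⟩ := hx
    exact ⟨by omega, (meetsDiagonal_iff ha _).2 ⟨k, rfl⟩⟩
  · intro x hx hx'
    simp only [Finset.mem_image, Finset.mem_filter, Finset.mem_range] at hx hx'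
    by_contra h
    obtain ⟨k, rfl⟩ := (meetsDiagonal_iff ha _).1 hx.2
    refine hx' ⟨k, ⟨?_, by omega⟩, rfl⟩
    have := le_front ha k
    omega

/-! ### Level functions of parking functions -/

/-- The number of vertices at depth less than `k`. -/
def countLT (d : Fin (n + 1) → ℕ) (k : ℕ) : ℕ := (Finset.univ.filter fun i => d i < k).card

/-- `d` is a depth function that is compatible with the parking function `a`: the entry at a
vertex of depth `k + 1` is the rank of a vertex of depth `k`. -/
def IsLevel (a : Fin n → ℕ) (d : Fin (n + 1) → ℕ) : Prop :=
  d 0 = 0 ∧ ∀ j : Fin n, 0 < d j.succ ∧ countLT d (d j.succ - 1) ≤ a j ∧ a j < countLT d (d j.succ)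

theorem countLT_mono (d : Fin (n + 1) → ℕ) : Monotone (countLT d) := fun _ _ h =>
  Finset.card_le_card (Finset.monotone_filter_right _ fun _ _ h' => lt_of_lt_of_le h' h)

theorem countLT_succ {d : Fin (n + 1) → ℕ} (h0 : d 0 = 0) (k : ℕ) :
    countLT d (k + 1) = (Finset.univ.filter fun j : Fin n => d j.succ ≤ k).card + 1 := by
  rw [countLT, Fin.card_filter_univ_succ, if_pos (by omega)]
  simp

theorem countLT_succ_sub (d : Fin (n + 1) → ℕ) (k : ℕ) :
    countLT d (k + 1) - countLT d k = (Finset.univ.filter fun i => d i = k).card := by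
  have : (Finset.univ.filter fun i => d i < k + 1) =
      (Finset.univ.filter fun i => d i < k) ∪ Finset.univ.filter fun i => d i = k := by
    ext i
    simp only [Finset.mem_filter, Finset.mem_univ, true_and, Finset.mem_union]
    omega
  rw [countLT, countLT, this, Finset.card_union_of_disjoint, Nat.add_sub_cancel_left]
  rw [Finset.disjoint_left]
  intro i h1 h2
  simp only [Finset.mem_filter, Finset.mem_univ, true_and] at h1 h2
  omega

theorem IsLevel.lt_countLT_iff {a : Fin n → ℕ} {d : Fin (n + 1) → ℕ} (h : IsLevel a d)
    (j : Fin n) (k : ℕ) : a j < countLT d k ↔ d j.succ ≤ k := by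
  obtain ⟨h1, h2, h3⟩ := h.2 j
  constructor
  · intro h'
    by_contra hk
    have := countLT_mono d (show k ≤ d j.succ - 1 by omega)
    omega
  · intro h'
    exact h3.trans_le (countLT_mono d h')

/-- Each bounce uncovers the next level: the entries at most `front a k` are those of the vertices
at depth at most `k + 1`. The extra `1` is the root. -/
theorem IsLevel.front_add_one {a : Fin n → ℕ} {d : Fin (n + 1) → ℕ} (h : IsLevel a d) (k : ℕ) :
    front a k + 1 = countLT d (k + 1) := by
  induction k with
  | zero =>
    rw [countLT_succ h.1, front]
    congr 1
    symm
    rw [Finset.card_eq_zero, Finset.filter_eq_empty_iff]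
    intro j _
    have := (h.2 j).1
    omega
  | succ k ih =>
    rw [countLT_succ h.1, front, countLE]
    congr 2
    ext j
    simp only [Finset.mem_filter, Finset.mem_univ, true_and]
    rw [← h.lt_countLT_iff, ← ih]
    omega

theorem IsLevel.le_front_iff {a : Fin n → ℕ} {d : Fin (n + 1) → ℕ} (h : IsLevel a d)
    (j : Fin n) (k : ℕ) : a j ≤ front a k ↔ d j.succ ≤ k + 1 := by
  rw [← h.lt_countLT_iff, ← h.front_add_one]
  omega

theorem IsLevel.front_eq_card {a : Fin n → ℕ} {d : Fin (n + 1) → ℕ} (h : IsLevel a d) (k : ℕ) :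
    front a k = (Finset.univ.filter fun j : Fin n => d j.succ ≤ k).card := by
  have := h.front_add_one k
  rw [countLT_succ h.1] at this
  omega

theorem IsLevel.unique {a : Fin n → ℕ} {d d' : Fin (n + 1) → ℕ} (h : IsLevel a d)
    (h' : IsLevel a d') : d = d' := by
  funext i
  refine Fin.cases (h.1.trans h'.1.symm) (fun j => ?_) i
  have h1 := (h.2 j).1
  have h1' := (h'.2 j).1
  have e := fun k => (h.le_front_iff j k).symm.trans (h'.le_front_iff j k)
  have e1 := e (d j.succ - 1)
  have e2 := e (d' j.succ - 1)
  omega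

theorem IsLevel.isParkingFunction {a : Fin n → ℕ} {d : Fin (n + 1) → ℕ} (h : IsLevel a d) :
    IsParkingFunction a := by
  rw [isParkingFunction_iff]
  intro i hi
  have hex : ∃ k, i < front a k := by
    -- The sum of the depths bounds each of them, so after that many bounces the front is `n`.
    refine ⟨∑ j : Fin n, d j.succ, ?_⟩
    rw [h.front_eq_card, Finset.filter_true_of_mem, Finset.card_univ, Fintype.card_fin]
    · exact hi
    · exact fun j _ => Finset.single_le_sum (f := fun j : Fin n => d j.succ)
        (fun _ _ => Nat.zero_le _) (Finset.mem_univ j)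
  have k1 := Nat.find_spec hex
  have k2 := fun m => Nat.find_min hex (m := m)
  rcases e : Nat.find hex with _ | k
  · rw [e] at k1
    exact absurd k1 (Nat.not_lt_zero _)
  · rw [e] at k1
    -- With `k + 1` the first bounce whose front exceeds `i`, `front a k ≤ i` holds, and `countLE`
    -- is monotone.
    exact k1.trans_le (countLE_mono a (not_lt.1 (k2 k (by omega))))

/-- The depth of a vertex is one more than the number of bounces after which the front first reaches
its entry. -/
theorem exists_isLevel {a : Fin n → ℕ} (ha : IsParkingFunction a) : ∃ d, IsLevel a d := by
  have hex : ∀ j, ∃ k, a j ≤ front a k := by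
    intro j
    refine ⟨n, ?_⟩
    have h1 := le_front ha n
    have h2 : a j < n := by
      have := mem_parkingFunctions.2 ha
      simp only [parkingFunctions, Finset.mem_filter, Fintype.mem_piFinset, Finset.mem_range] at this
      exact this.1 j
    omega
  have hfind : ∀ j k, Nat.find (hex j) ≤ k ↔ a j ≤ front a k := fun j k =>
    ⟨fun h => (Nat.find_spec (hex j)).trans (front_mono a h), fun h => Nat.find_min' _ h⟩
  let d : Fin (n + 1) → ℕ := Fin.cons 0 fun j => Nat.find (hex j) + 1
  have d0 : d 0 = 0 := rfl
  have ds : ∀ j : Fin n, d j.succ = Nat.find (hex j) + 1 := fun j => rfl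
  have hN : ∀ k, countLT d (k + 1) = front a k + 1 := by
    intro k
    rw [countLT_succ d0]
    congr 1
    obtain _ | k := k
    · simp [ds, front]
    · simp only [ds, Nat.add_le_add_iff_right, hfind]
      rfl
  refine ⟨d, d0, fun j => ?_⟩
  rw [ds, hN, Nat.add_sub_cancel]
  refine ⟨Nat.succ_pos _, ?_, Nat.lt_succ_of_le (Nat.find_spec (hex j))⟩
  rcases e : Nat.find (hex j) with _ | m
  · simp [countLT]
  · rw [hN]
    have := mt (hfind j m).2 (by omega)
    omega

/-- After `k` bounces, `n - front a k` counts the vertices deeper than `k`; summed over `k`, a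
vertex is counted as often as its depth. -/
theorem IsLevel.bounce_eq {a : Fin n → ℕ} {d : Fin (n + 1) → ℕ} (h : IsLevel a d) :
    DepthBounce.bounce a = ∑ i, d i := by
  -- This number of terms is at least `n` and at least every depth.
  rw [bounce_eq_sum h.isParkingFunction (K := n + ∑ j : Fin n, d j.succ) (by omega),
    Fin.sum_univ_succ, h.1, zero_add]
  have e : ∀ k, n - front a k = ∑ j : Fin n, if k < d j.succ then 1 else 0 := by
    intro k
    have := Finset.card_filter_add_card_filter_not (s := (Finset.univ : Finset (Fin n)))
      (fun j => d j.succ ≤ k)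
    simp only [not_le, Finset.card_univ, Fintype.card_fin] at this
    rw [h.front_eq_card, ← Finset.card_filter]
    omega
  simp only [e]
  rw [Finset.sum_comm]
  refine Finset.sum_congr rfl fun j _ => ?_
  have hj : d j.succ ≤ ∑ j : Fin n, d j.succ :=
    Finset.single_le_sum (f := fun j : Fin n => d j.succ)
      (fun _ _ => Nat.zero_le _) (Finset.mem_univ j)
  rw [← Finset.card_filter]
  have : ((Finset.range (n + ∑ j : Fin n, d j.succ)).filter fun k => k < d j.succ) =
      Finset.range (d j.succ) := by
    ext k
    simp only [Finset.mem_filter, Finset.mem_range]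
    omega
  rw [this, Finset.card_range]

open Classical in
/-- The depth function of a parking function. -/
def level (a : Fin n → ℕ) : Fin (n + 1) → ℕ := if h : ∃ d, IsLevel a d then h.choose else 0

theorem IsLevel.level_eq {a : Fin n → ℕ} {d : Fin (n + 1) → ℕ} (h : IsLevel a d) :
    level a = d := by
  have h' : ∃ d, IsLevel a d := ⟨d, h⟩
  rw [level, dif_pos h']
  exact h'.choose_spec.unique h

theorem isLevel_level {a : Fin n → ℕ} (ha : IsParkingFunction a) : IsLevel a (level a) := by
  obtain ⟨d, h⟩ := exists_isLevel ha
  rwa [h.level_eq]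

end Parking

theorem sum_eq_of_card_fiber_eq {α β γ M : Type*} [DecidableEq γ] [AddCommMonoid M]
    {s : Finset α} {t : Finset β} {f : α → γ} {g : β → γ}
    (h : ∀ c, (s.filter fun a => f a = c).card = (t.filter fun b => g b = c).card) (F : γ → M) :
    ∑ a ∈ s, F (f a) = ∑ b ∈ t, F (g b) := by
  have : s.val.map f = t.val.map g := by
    ext c
    simpa [Multiset.count_map, eq_comm, Finset.card_def] using h c
  change (s.val.map fun a => F (f a)).sum = (t.val.map fun b => F (g b)).sum
  rw [← Function.comp_def, ← Function.comp_def, ← Multiset.map_map, this, Multiset.map_map]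

/-! ### Trees and parking functions with given depths -/

section Fibers

variable {n : ℕ}

/-- Any choice of parents one level up gives a tree, since `d` itself certifies that there are no
cycles. -/
theorem filter_depth_eq {d : Fin (n + 1) → ℕ} (h0 : d 0 = 0) (hd : ∀ j : Fin n, 0 < d j.succ) :
    ((parentMaps 0 (Finset.univ.erase (0 : Fin (n + 1)))).filter fun p =>
      depth 0 (Finset.univ.erase 0) p = d) =
    Fintype.piFinset fun j => if j = 0 then {0} else Finset.univ.filter fun i => d i = d j - 1 := by
  ext p
  rw [Finset.mem_filter, Fintype.mem_piFinset]
  constructor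
  · rintro ⟨hp, rfl⟩ j
    obtain ⟨h1, h2⟩ := mem_parentMaps.1 hp
    by_cases hj : j = 0
    · simp [hj, h1 0 (by simp)]
    · have := (h2.2 j (by simp [hj])).2
      simp [hj, this]
  · intro h
    have hD : IsDepth 0 (Finset.univ.erase 0) p d := by
      refine ⟨h0, fun j hj => ⟨by simp [Finset.insert_erase], ?_⟩⟩
      obtain ⟨i, rfl⟩ := Fin.exists_succ_eq.2 (Finset.ne_of_mem_erase hj)
      have := h i.succ
      simp only [Fin.succ_ne_zero, if_false, Finset.mem_filter, Finset.mem_univ, true_and] at this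
      have := hd i
      omega
    refine ⟨mem_parentMaps.2 ⟨fun j hj => ?_, hD.depth⟩, hD.depth_eq⟩
    have hj : j = 0 := by simpa using hj
    subst hj
    simpa using h 0

theorem filter_level_eq {d : Fin (n + 1) → ℕ} (h0 : d 0 = 0) (hd : ∀ j : Fin n, 0 < d j.succ) :
    ((parkingFunctions n).filter fun a => level a = d) =
      Fintype.piFinset fun j : Fin n =>
        Finset.Ico (countLT d (d j.succ - 1)) (countLT d (d j.succ)) := by
  ext a
  rw [Finset.mem_filter, Fintype.mem_piFinset, mem_parkingFunctions]
  simp only [Finset.mem_Ico]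
  constructor
  · rintro ⟨ha, rfl⟩ j
    exact ((isLevel_level ha).2 j).2
  · intro h
    have hL : IsLevel a d := ⟨h0, fun j => ⟨hd j, h j⟩⟩
    exact ⟨hL.isParkingFunction, hL.level_eq⟩

theorem card_fiber_eq (d : Fin (n + 1) → ℕ) :
    ((parentMaps 0 (Finset.univ.erase (0 : Fin (n + 1)))).filter fun p =>
      depth 0 (Finset.univ.erase 0) p = d).card =
    ((parkingFunctions n).filter fun a => level a = d).card := by
  by_cases h : d 0 = 0 ∧ ∀ j : Fin n, 0 < d j.succ
  · rw [filter_depth_eq h.1 h.2, filter_level_eq h.1 h.2, Fintype.card_piFinset,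
      Fintype.card_piFinset, Fin.prod_univ_succ]
    simp only [if_true, Finset.card_singleton, one_mul, Fin.succ_ne_zero, if_false, Nat.card_Ico]
    refine Finset.prod_congr rfl fun j _ => ?_
    have := h.2 j
    -- The interval allowed for the entry at `j` has as many elements as there are vertices at depth
    -- `d j.succ - 1`.
    rw [← countLT_succ_sub, Nat.sub_add_cancel this]
  · rw [Finset.filter_eq_empty_iff.2, Finset.filter_eq_empty_iff.2]
    · rfl
    · rintro a ha rfl
      have := isLevel_level (mem_parkingFunctions.1 ha)
      exact h ⟨this.1, fun j => (this.2 j).1⟩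
    · rintro p hp rfl
      have := (mem_parentMaps.1 hp).2
      refine h ⟨this.1, fun j => ?_⟩
      rw [(this.2 j.succ (by simp)).2]
      exact Nat.succ_pos _

theorem sum_parkingFunctions {M : Type*} [AddCommMonoid M] (F : ℕ → M) :
    ∑ a ∈ parkingFunctions n, F (DepthBounce.bounce a) =
      ∑ p ∈ parentMaps 0 (Finset.univ.erase (0 : Fin (n + 1))),
        F (depthProfile 0 (Finset.univ.erase 0) p).sum := by
  have e1 : ∀ a ∈ parkingFunctions n, F (DepthBounce.bounce a) = F (∑ i, level a i) :=
    fun a ha => by rw [(isLevel_level (mem_parkingFunctions.1 ha)).bounce_eq]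
  rw [Finset.sum_congr rfl e1, ← sum_eq_of_card_fiber_eq card_fiber_eq fun d => F (∑ i, d i)]
  refine Finset.sum_congr rfl fun p _ => ?_
  rw [depthProfile, Finset.insert_erase (Finset.mem_univ _)]
  rfl

end Fibers

theorem sum_minimalFactorizations_eq_sum_labelledTrees {n : ℕ} {M : Type*} [AddCommMonoid M]
    (F : ℕ → M) : ∑ t ∈ minimalFactorizations n, F (totalDifference t) =
      ∑ T ∈ labelledTrees n, F (totalDepth T) := by
  have e : (nonRoots n).toFinset = Finset.univ.erase 0 := by
    ext i
    simp [mem_nonRoots]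
  rw [sum_minimalFactorizations, sum_labelledTrees, ← e]
  exact sum_profile_eq_sum_depthProfile n (nonRoots n) 0 (fun μ => F μ.sum) length_nonRoots
    ((List.nodup_finRange n).map (Fin.succ_injective n)) (by simp [mem_nonRoots])

theorem sum_parkingFunctions_eq_sum_labelledTrees {n : ℕ} {M : Type*} [AddCommMonoid M]
    (F : ℕ → M) : ∑ a ∈ parkingFunctions n, F (DepthBounce.bounce a) =
      ∑ T ∈ labelledTrees n, F (totalDepth T) := by
  rw [sum_parkingFunctions, sum_labelledTrees]

end DepthBounce

end

open DepthBounce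
theorem theorem2p3 (n : ℕ) :
    (∀ k : ℕ,
      ((labelledTrees n).filter fun T => totalDepth T = k).card =
        ((minimalFactorizations n).filter fun f => totalDifference f = k).card ∧
      ((minimalFactorizations n).filter fun f => totalDifference f = k).card =
        ((parkingFunctions n).filter fun p => DepthBounce.bounce p = k).card) ∧
    D n = ∑ T ∈ labelledTrees n, (X : ℤ[X]) ^ totalDepth T ∧
    D n = ∑ f ∈ minimalFactorizations n, (X : ℤ[X]) ^ totalDifference f ∧
    D n = ∑ p ∈ parkingFunctions n, (X : ℤ[X]) ^ DepthBounce.bounce p := by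
  have hD : D n = ∑ T ∈ labelledTrees n, (X : ℤ[X]) ^ totalDepth T := by
    refine Finset.sum_congr rfl fun T hT => ?_
    rw [inv_add_coinv (by simpa [labelledTrees] using hT)]
  refine ⟨fun k => ?_, hD, ?_, ?_⟩
  -- Summing the indicator of the value `k` counts the objects with that statistic.
  · have h1 := sum_minimalFactorizations_eq_sum_labelledTrees (n := n) fun m => if m = k then 1 else 0
    have h2 := sum_parkingFunctions_eq_sum_labelledTrees (n := n) fun m => if m = k then 1 else 0
    simp only [← Finset.card_filter] at h1 h2
    exact ⟨h1.symm, h1.trans h2.symm⟩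
  · rw [hD, sum_minimalFactorizations_eq_sum_labelledTrees fun m => (X : ℤ[X]) ^ m]
  · rw [hD, sum_parkingFunctions_eq_sum_labelledTrees fun m => (X : ℤ[X]) ^ m]
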